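/- Let $\hbar,M,L>0$, $\nu,\beta\ge 0$, $\varepsilon_0=\hbar^2\pi^2/(2ML^2)$. On $L^2(0,L)$ consider the Pöschl–Teller Hamiltonian $$H=-\frac{\hbar^2}{2M}\frac{d^2}{dx^2}+\varepsilon_0\Big(\frac{\nu(\nu+1)}{\sin^2(\pi x/L)}-2\beta\cot\frac{\pi x}{L}\Big)$$ with Dirichlet boundary conditions. For $n\in\mathbb N=\{0,1,2,\dots\}$ put $E_n=\varepsilon_0\big((n+\nu+1)^2-\frac{\beta^2}{(n+\nu+1)^2}\big)$, $a_n=-(n+\nu+1)+\frac{i\beta}{n+\nu+1}$, and $$\phi_n(x)=K_n\sin^{\nu+n+1}\Big(\frac{\pi x}{L}\Big)\exp\Big(-\frac{\beta\pi x}{L(\nu+n+1)}\Big)P_n^{(a_n,\bar a_n)}\Big(i\cot\frac{\pi x}{L}\Big),$$ $$K_n=2^{n+\nu+1}L^{-1/2}\,\mathcal T(n)\,\mathcal O(n)^{-1/2}\exp\Big(\frac{\beta\pi}{2(n+\nu+1)}\Big),\qquad \mathcal T(n)=n!\,\Big|\Big(-n-\nu+\frac{i\beta}{n+\nu+1}\Big)_n\Big|^{-1},$$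 $$\mathcal O(n)=\sum_{k=0}^n\frac{(-n)_k(-2\nu-n-1)_k}{(-\nu-n-\frac{i\beta}{\nu+n+1})_k\,k!\,\Gamma(n+\nu+2-k+\frac{i\beta}{\nu+n+1})}\sum_{s=0}^n\frac{(-n)_s(-2\nu-n-1)_s\,\Gamma(2n+2\nu-s-k+3)}{(-\nu-n+\frac{i\beta}{\nu+n+1})_s\,s!\,\Gamma(n+\nu+2-s-\frac{i\beta}{\nu+n+1})},$$ where $P_n^{(a,b)}$ are the Jacobi polynomials and $(z)_k=z(z+1)\cdots(z+k-1)$. Define recursively, for $k=0,1,2,\dots$, $$\phi_n^{(k)}=\frac{A_{k-1}\cdots A_1A_0\,\phi_{n+k}}{\sqrt{(2M)^k\prod_{j=0}^{k-1}(E_{n+k}-E_j)}},\quad W_k=-\hbar\frac{(\phi_0^{(k)})'}{\phi_0^{(k)}},\quad A_k=\hbar\frac{d}{dx}+W_k,\quad A_k^\dagger=-\hbar\frac{d}{dx}+W_k,$$ with $A_k$ taken on its maximal domain in $L^2(0,L)$ and $A_k^\dagger$ its adjoint, and put $E_n^{(k)}=E_{n+k}$, $H^{(m+1)}=\frac1{2M}A_mA_m^\dagger+E_0^{(m)}$,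 $B_m=A_m\cdots A_1A_0$, $B_m^\dagger=A_0^\dagger A_1^\dagger\cdots A_m^\dagger$. Then for all $n,m\in\mathbb N$ the $\phi_j^{(k)}$ ($k\le m+1$, $j\in\mathbb N$) are well-defined smooth functions on $(0,L)$, the ground states $\phi_0^{(k)}$ ($k\le m$) having no zeros there; $\phi_n$ and $\phi_n^{(m+1)}$ are normalized eigenfunctions of $H$ and $H^{(m+1)}$ for the eigenvalues $E_n$ and $E_n^{(m+1)}$; the function $\phi_n^{(m+1)}$ lies in the domain of $B_m^\dagger$ and $\phi_{n+m+1}$ in the domain of $B_m$; and for all $x\in(0,L)$ $$\begin{aligned}B_m^\dagger\phi_n^{(m+1)}(x)={}&2^{n+m+\nu+2}\Big(\frac{\hbar\pi}{L}\Big)^{m+1}\mathcal T(n+m+1)\,\big[L\,\mathcal O(n+m+1)\big]^{-1/2}\exp\Big[\frac{\beta\pi}{n+m+\nu+2}\Big(\frac12-\frac xL\Big)\Big]\\&\times\mathcal M(n,m)\,\sin^{n+m+\nu+2}\Big(\frac{\pi x}{L}\Big)\,P_{n+m+1}^{(a_{n+m+1},\bar a_{n+m+1})}\Big(i\cot\frac{\pi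 x}{L}\Big),\end{aligned}$$ $$B_m\phi_{n+m+1}(x)=\Big(\frac{\pi\hbar}{L}\Big)^{m+1}\mathcal M(n,m)\,\phi_n^{(m+1)}(x),$$ where $\mathcal M(n,m)>0$ is given by $$\mathcal M^2(n,m)=\prod_{k=0}^m(n+m-k+1)(n+m+2\nu+k+3)\Big(1+\frac{\beta^2}{[(k+\nu+1)(n+m+\nu+2)]^2}\Big).$$ -/

import Mathlib

open MeasureTheory Set Filter Topology
open scoped ContDiff

noncomputable section

/-- The Jacobi polynomial `P_n^{(a,b)}(z)`, for arbitrary complex parameters: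
`∑_{k ≤ n} (n+a+b+1)_k (a+k+1)_{n-k} / (k! (n-k)!) ((z-1)/2)^k`. -/
def jacobiP (n : ℕ) (a b z : ℂ) : ℂ :=
  ∑ k ∈ Finset.range (n + 1),
    (ascPochhammer ℂ k).eval (n + a + b + 1) * (ascPochhammer ℂ (n - k)).eval (a + k + 1)
      / ((k.factorial : ℂ) * ((n - k).factorial : ℂ)) * ((z - 1) / 2) ^ k

/-- The parameters of the model: Planck's constant `ħ`, the mass `M`, the width `L` of the interval
`[0, L]`, and the dimensionless parameters `ν`, `β`. -/
structure PoschlTeller where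
  ħ : ℝ
  M : ℝ
  L : ℝ
  ν : ℝ
  β : ℝ

namespace PoschlTeller

variable (p : PoschlTeller)

/-! ### The Hamiltonian, its eigenvalues and its eigenfunctions -/

/-- The energy scale `ε₀ = ħ² π² / (2 M L²)`. -/
def eps0 : ℝ := p.ħ ^ 2 * Real.pi ^ 2 / (2 * p.M * p.L ^ 2)

/-- The potential `V(x) = ε₀ (ν(ν+1) / sin²(πx/L) - 2β cot(πx/L))`. -/
def potential (x : ℝ) : ℝ :=
  p.eps0 * (p.ν * (p.ν + 1) / Real.sin (Real.pi * x / p.L) ^ 2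
    - 2 * p.β * Real.cot (Real.pi * x / p.L))

/-- The eigenvalue `E_n = ε₀ ((n+ν+1)² - β² / (n+ν+1)²)`. -/
def energy (n : ℕ) : ℝ :=
  p.eps0 * ((n + p.ν + 1) ^ 2 - p.β ^ 2 / (n + p.ν + 1) ^ 2)

/-- `a_n = -(n+ν+1) + i β / (n+ν+1)`. -/
def aParam (n : ℕ) : ℂ :=
  -((n : ℂ) + p.ν + 1) + Complex.I * p.β / ((n : ℂ) + p.ν + 1)

/-- `T(n) = n! / |(-n-ν + iβ/(n+ν+1))_n|`. -/
def calT (n : ℕ) : ℝ :=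
  (n.factorial : ℝ) *
    ‖(ascPochhammer ℂ n).eval (-(n : ℂ) - p.ν + Complex.I * p.β / ((n : ℂ) + p.ν + 1))‖⁻¹

/-- The double sum `O(n)`, written as the complex expression it is (its value is real). -/
def calO (n : ℕ) : ℂ :=
  ∑ k ∈ Finset.range (n + 1),
    (ascPochhammer ℂ k).eval (-(n : ℂ)) * (ascPochhammer ℂ k).eval (-2 * (p.ν : ℂ) - n - 1)
      / ((ascPochhammer ℂ k).eval (-(p.ν : ℂ) - n - Complex.I * p.β / ((n : ℂ) + p.ν + 1))
          * (k.factorial : ℂ)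
          * Complex.Gamma (n + p.ν + 2 - k + Complex.I * p.β / ((n : ℂ) + p.ν + 1)))
      * ∑ s ∈ Finset.range (n + 1),
          (ascPochhammer ℂ s).eval (-(n : ℂ)) * (ascPochhammer ℂ s).eval (-2 * (p.ν : ℂ) - n - 1)
            * Complex.Gamma (2 * n + 2 * p.ν - s - k + 3)
            / ((ascPochhammer ℂ s).eval (-(p.ν : ℂ) - n + Complex.I * p.β / ((n : ℂ) + p.ν + 1))
                * (s.factorial : ℂ)
                * Complex.Gamma (n + p.ν + 2 - s - Complex.I * p.β / ((n : ℂ) + p.ν + 1)))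

/-- The normalization constant `K_n = 2^{n+ν+1} L^{-1/2} T(n) O(n)^{-1/2} exp(βπ/(2(n+ν+1)))`. -/
def normK (n : ℕ) : ℂ :=
  ((2 : ℝ) ^ ((n : ℝ) + p.ν + 1) : ℝ) * ((p.L ^ (-(1 / 2) : ℝ) : ℝ) : ℂ) * p.calT n
    * p.calO n ^ (-(1 / 2) : ℂ) * (Real.exp (p.β * Real.pi / (2 * (n + p.ν + 1))) : ℝ)

/-- The eigenfunction
`φ_n(x) = K_n sin^{ν+n+1}(πx/L) exp(-βπx/(L(ν+n+1))) P_n^{(a_n, conj a_n)}(i cot(πx/L))`. -/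
def phi (n : ℕ) (x : ℝ) : ℂ :=
  p.normK n * ((Real.sin (Real.pi * x / p.L) ^ (p.ν + n + 1) : ℝ) : ℂ)
    * (Real.exp (-(p.β * Real.pi * x / (p.L * (p.ν + n + 1)))) : ℝ)
    * jacobiP n (p.aParam n) (starRingEnd ℂ (p.aParam n))
        (Complex.I * (Real.cot (Real.pi * x / p.L) : ℝ))

/-! ### The hierarchy

All differential expressions act on functions `ℝ → ℂ`, of which only the restriction to the open
interval `(0, L)` matters. -/

/-- The superpotential `-ħ g' / g` attached to a ground state `g`. -/
def superpotOf (g : ℝ → ℂ) (x : ℝ) : ℂ := -(p.ħ : ℂ) * deriv g x / g x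

/-- `√((2M)^k ∏_{j<k} (E_{n+k} - E_j))`. -/
def normHier (k n : ℕ) : ℝ :=
  Real.sqrt ((2 * p.M) ^ k * ∏ j ∈ Finset.range k, (p.energy (n + k) - p.energy j))

/-- The product `A_{k-1} ⋯ A_1 A_0` (the identity for `k = 0`). The next factor is
`A_k = ħ d/dx + W_k`, with `W_k` the superpotential of the ground state of level `k`, which is
itself obtained from `φ_k` by the product of the first `k` factors; see `ladder_succ`. -/
def ladder : ℕ → (ℝ → ℂ) → ℝ → ℂ
  | 0, f => f
  | k + 1, f => fun x =>
      (p.ħ : ℂ) * deriv (ladder k f) x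
        + p.superpotOf (fun y => ladder k (p.phi (0 + k)) y / (p.normHier k 0 : ℂ)) x
          * ladder k f x

/-- The eigenfunction of level `k`,
`φ_n^{(k)} = A_{k-1} ⋯ A_0 φ_{n+k} / √((2M)^k ∏_{j<k} (E_{n+k} - E_j))`. -/
def phiHier (k n : ℕ) (x : ℝ) : ℂ := p.ladder k (p.phi (n + k)) x / (p.normHier k n : ℂ)

/-- The superpotential of level `k`, `W_k = -ħ (φ_0^{(k)})' / φ_0^{(k)}`. -/
def superpot (k : ℕ) : ℝ → ℂ := p.superpotOf (p.phiHier k 0)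

/-- `A_k = ħ d/dx + W_k`. -/
def opA (k : ℕ) (f : ℝ → ℂ) (x : ℝ) : ℂ := (p.ħ : ℂ) * deriv f x + p.superpot k x * f x

/-- `A_k† = -ħ d/dx + W_k`. -/
def opAdag (k : ℕ) (f : ℝ → ℂ) (x : ℝ) : ℂ := -(p.ħ : ℂ) * deriv f x + p.superpot k x * f x

theorem ladder_succ (k : ℕ) (f : ℝ → ℂ) : p.ladder (k + 1) f = p.opA k (p.ladder k f) := rfl

/-- The product `A_0† A_1† ⋯ A_{k-1}†` (the identity for `k = 0`). -/
def ladderDag : ℕ → (ℝ → ℂ) → ℝ → ℂ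
  | 0, f => f
  | k + 1, f => ladderDag k (p.opAdag k f)

/-- `B_m = A_m ⋯ A_1 A_0`. -/
def opB (m : ℕ) (f : ℝ → ℂ) : ℝ → ℂ := p.ladder (m + 1) f

/-- `B_m† = A_0† A_1† ⋯ A_m†`. -/
def opBdag (m : ℕ) (f : ℝ → ℂ) : ℝ → ℂ := p.ladderDag (m + 1) f

/-- The eigenvalues of the hierarchy: `E_n^{(0)} = E_n`, `E_n^{(m+1)} = E_{n+1}^{(m)}`. -/
def energyHier : ℕ → ℕ → ℝ
  | 0, n => p.energy n
  | m + 1, n => energyHier m (n + 1)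

/-- The Hamiltonian `H f = -(ħ²/2M) f'' + V f`. -/
def hamiltonian (f : ℝ → ℂ) (x : ℝ) : ℂ :=
  -((p.ħ ^ 2 / (2 * p.M) : ℝ) : ℂ) * deriv (deriv f) x + (p.potential x : ℂ) * f x

/-- The superpartner Hamiltonian `H^{(m+1)} f = (1/2M) A_m A_m† f + E_0^{(m)} f`. -/
def hamiltonianHier (m : ℕ) (f : ℝ → ℂ) (x : ℝ) : ℂ :=
  ((1 / (2 * p.M) : ℝ) : ℂ) * p.opA m (p.opAdag m f) x + (p.energyHier m 0 : ℂ) * f x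

/-! ### Domains in `L²(0, L)` -/

/-- `f` (restricted to `(0, L)`) belongs to `L²(0, L)`. -/
def MemL2 (f : ℝ → ℂ) : Prop := MemLp f 2 (volume.restrict (Ioo 0 p.L))

/-- The inner product of `L²(0, L)`, conjugate-linear in the first variable. -/
def innerL2 (u v : ℝ → ℂ) : ℂ := ∫ x in Ioo 0 p.L, starRingEnd ℂ (u x) * v x

/-- `f` is absolutely continuous on every compact subinterval of `(0, L)`. -/
def LocAC (f : ℝ → ℂ) : Prop :=
  ∀ a b : ℝ, 0 < a → a < b → b < p.L → AbsolutelyContinuousOnInterval f a b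

/-- The domain of `A_k` in `L²(0, L)`. -/
def MemDomA (k : ℕ) (f : ℝ → ℂ) : Prop :=
  p.MemL2 f ∧ p.LocAC f ∧ p.MemL2 (p.opA k f)

/-- The domain of `A_k†`, the adjoint of `A_k` in `L²(0, L)`: for all `ψ` in the domain of `A_k`
the boundary terms `ħ conj(ψ) f` at `0` and at `L` cancel and `⟨A_k ψ, f⟩ = ⟨ψ, A_k† f⟩`. -/
def MemDomAdag (k : ℕ) (f : ℝ → ℂ) : Prop :=
  p.MemL2 f ∧ p.LocAC f ∧ p.MemL2 (p.opAdag k f) ∧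
    ∀ ψ : ℝ → ℂ, p.MemDomA k ψ →
      (∃ c : ℂ,
        Tendsto (fun x => (p.ħ : ℂ) * starRingEnd ℂ (ψ x) * f x) (𝓝[>] 0) (𝓝 c) ∧
        Tendsto (fun x => (p.ħ : ℂ) * starRingEnd ℂ (ψ x) * f x) (𝓝[<] p.L) (𝓝 c)) ∧
      p.innerL2 (p.opA k ψ) f = p.innerL2 ψ (p.opAdag k f)

/-- The domain of the product `A_{k-1} ⋯ A_0` of unbounded operators. -/
def MemDomLadder : ℕ → (ℝ → ℂ) → Prop
  | 0, f => p.MemL2 f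
  | k + 1, f => MemDomLadder k f ∧ p.MemDomA k (p.ladder k f)

/-- The domain of the product `A_0† ⋯ A_{k-1}†` of unbounded operators. -/
def MemDomLadderDag : ℕ → (ℝ → ℂ) → Prop
  | 0, f => p.MemL2 f
  | k + 1, f => p.MemDomAdag k f ∧ MemDomLadderDag k (p.opAdag k f)

/-- The domain of `B_m`. -/
def MemDomB (m : ℕ) (f : ℝ → ℂ) : Prop := p.MemDomLadder (m + 1) f

/-- The domain of `B_m†`. -/
def MemDomBdag (m : ℕ) (f : ℝ → ℂ) : Prop := p.MemDomLadderDag (m + 1) f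

/-- The domain of `H`: functions in `L²` which are locally absolutely continuous together with
their derivative, satisfy Dirichlet boundary conditions, and are mapped to `L²` by `H`. -/
def MemDomH (f : ℝ → ℂ) : Prop :=
  p.MemL2 f ∧ p.LocAC f ∧ p.LocAC (deriv f) ∧
    Tendsto f (𝓝[>] 0) (𝓝 0) ∧ Tendsto f (𝓝[<] p.L) (𝓝 0) ∧ p.MemL2 (p.hamiltonian f)

/-- The domain of `H^{(m+1)} = (1/2M) A_m A_m† + E_0^{(m)}`. -/
def MemDomHHier (m : ℕ) (f : ℝ → ℂ) : Prop :=
  p.MemDomAdag m f ∧ p.MemDomA m (p.opAdag m f)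

/-- `f` is a unit vector of `L²(0, L)`. -/
def IsUnitVector (f : ℝ → ℂ) : Prop := p.MemL2 f ∧ p.innerL2 f f = 1

/-- `f` is a normalized eigenfunction of `H` with eigenvalue `E`. -/
def IsNormalizedEigenfunction (E : ℝ) (f : ℝ → ℂ) : Prop :=
  p.MemDomH f ∧ p.IsUnitVector f ∧ ∀ x ∈ Ioo 0 p.L, p.hamiltonian f x = (E : ℂ) * f x

/-- `f` is a normalized eigenfunction of `H^{(m+1)}` with eigenvalue `E`. -/
def IsNormalizedEigenfunctionHier (m : ℕ) (E : ℝ) (f : ℝ → ℂ) : Prop :=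
  p.MemDomHHier m f ∧ p.IsUnitVector f ∧ ∀ x ∈ Ioo 0 p.L, p.hamiltonianHier m f x = (E : ℂ) * f x

/-- The positive square root `M(n,m)` of
`∏_{k=0}^m (n+m-k+1)(n+m+2ν+k+3)(1 + β²/[(k+ν+1)(n+m+ν+2)]²)`. -/
def calM (n m : ℕ) : ℝ :=
  Real.sqrt (∏ k ∈ Finset.range (m + 1),
    ((n : ℝ) + m - k + 1) * ((n : ℝ) + m + 2 * p.ν + k + 3)
      * (1 + p.β ^ 2 / (((k : ℝ) + p.ν + 1) * ((n : ℝ) + m + p.ν + 2)) ^ 2))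

end PoschlTeller

end

/-!
Every function of the hierarchy has the form `sin^e(θ) exp(-βθ/e) R(cot θ)` with `θ = πx/L`,
`e = n + ν + 1` and `R` a polynomial, and `d/dx` acts on the factor `R` through the operator
`cotDeriv`. The ground state of level `k` has logarithmic derivative `e_k cot θ - β/e_k` with
`e_k = k + ν + 1`. By its two Riccati identities, `A_k† A_k` recovers the Hamiltonian with `ν`
replaced by `ν + k`, while `A_k A_k†` yields the one with `ν + k + 1`. This shape invariance gives
all eigenvalue equations, and `M(n,m)²` is the product of the resulting factors `E_{n+m+1} - E_k`.
Integration by parts reduces the norms to that of `φ_n`. There, expanding the Jacobi polynomial in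
powers of `e^{i(θ - π/2)} / (2 sin θ)` turns `‖φ_n‖²` into a double sum of Cauchy integrals
`∫₀^π sin^s θ e^{iyθ} dθ`, whose Gamma function values are the terms of `O(n)`.
-/

section CauchyIntegral

open scoped Real

/-- The integrand `sin^s θ e^{iy(θ - π/2)}` of Cauchy's integral. -/
noncomputable def sinExp (s : ℝ) (y : ℂ) (θ : ℝ) : ℂ :=
  ((Real.sin θ ^ s : ℝ) : ℂ) * Complex.exp (Complex.I * y * ((θ : ℂ) - π / 2))

/-- Cauchy's integral `∫₀^π sin^s θ e^{iy(θ - π/2)} dθ`. -/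
noncomputable def sinExpIntegral (s : ℝ) (y : ℂ) : ℂ :=
  ∫ θ in (0 : ℝ)..π, sinExp s y θ

theorem continuous_sinExp {s : ℝ} (hs : 0 ≤ s) (y : ℂ) : Continuous (sinExp s y) := by
  have : Continuous fun θ : ℝ => Real.sin θ ^ s :=
    Real.continuous_sin.rpow_const fun _ => Or.inr hs
  unfold sinExp
  fun_prop

theorem intervalIntegrable_sinExp {s : ℝ} (hs : 0 ≤ s) (y : ℂ) (a b : ℝ) :
    IntervalIntegrable (sinExp s y) volume a b :=
  (continuous_sinExp hs y).intervalIntegrable a b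

theorem sinExp_add_one {θ : ℝ} (hθ : 0 < Real.sin θ) (s : ℝ) (y : ℂ) :
    sinExp (s + 1) y θ = Real.sin θ * sinExp s y θ := by
  rw [sinExp, sinExp, Real.rpow_add_one hθ.ne']
  push_cast
  ring

theorem sinExp_zero {s : ℝ} (hs : s ≠ 0) (y : ℂ) : sinExp s y 0 = 0 := by
  simp [sinExp, hs]

theorem sinExp_pi {s : ℝ} (hs : s ≠ 0) (y : ℂ) : sinExp s y π = 0 := by
  simp [sinExp, hs]

theorem hasDerivAt_sinExp {θ : ℝ} (hθ : 0 < Real.sin θ) (s : ℝ) (y : ℂ) :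
    HasDerivAt (sinExp (s + 1) y)
      ((s + 1) * Real.cos θ * sinExp s y θ + Complex.I * y * sinExp (s + 1) y θ) θ := by
  have hsin := ((Real.hasDerivAt_sin θ).rpow_const (p := s + 1) (Or.inl hθ.ne')).ofReal_comp
  have hexp : HasDerivAt (fun θ : ℝ => Complex.exp (Complex.I * y * ((θ : ℂ) - π / 2)))
      (Complex.exp (Complex.I * y * ((θ : ℂ) - π / 2)) * (Complex.I * y * 1)) θ :=
    (((hasDerivAt_id θ).ofReal_comp.sub_const _).const_mul (Complex.I * y)).cexp
  convert! hsin.mul hexp using 1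
  simp only [sinExp, add_sub_cancel_right]
  push_cast
  ring

-- Integrate the derivative of `iy sin^{s+2} e - (s+2) cos sin^{s+1} e` over `[0, π]`.
theorem sinExpIntegral_add_two {s : ℝ} (hs : 0 ≤ s) (y : ℂ) :
    (((s : ℂ) + 2) ^ 2 - y ^ 2) * sinExpIntegral (s + 2) y
      = (s + 1) * (s + 2) * sinExpIntegral s y := by
  have hderiv (θ : ℝ) (hθ : θ ∈ Ioo 0 π) : HasDerivAt
      (fun θ : ℝ => Complex.I * y * sinExp (s + 1 + 1) y θ
        - (s + 2) * (Real.cos θ * sinExp (s + 1) y θ))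
      ((((s : ℂ) + 2) ^ 2 - y ^ 2) * sinExp (s + 1 + 1) y θ
        - (s + 1) * (s + 2) * sinExp s y θ) θ := by
    have hsin := Real.sin_pos_of_mem_Ioo hθ
    convert! ((hasDerivAt_sinExp hsin (s + 1) y).const_mul (Complex.I * y)).sub
      (((Real.hasDerivAt_cos θ).ofReal_comp.mul (hasDerivAt_sinExp hsin s y)).const_mul
        ((s : ℂ) + 2)) using 1
    rw [sinExp_add_one hsin, sinExp_add_one hsin]
    push_cast
    linear_combination
      (((s : ℂ) + 1) * (s + 2) * sinExp s y θ) * Complex.sin_sq_add_cos_sq θ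
        - (y ^ 2 * Complex.sin θ ^ 2 * sinExp s y θ) * Complex.I_sq
  have hint := intervalIntegrable_sinExp (s := s + 1 + 1) (by positivity) y 0 π
  have hint' := intervalIntegrable_sinExp hs y 0 π
  have hcont := continuous_sinExp (s := s + 1 + 1) (by positivity) y
  have hcont' := continuous_sinExp (s := s + 1) (by positivity) y
  have key := intervalIntegral.integral_eq_sub_of_hasDerivAt_of_le Real.pi_pos.le
    (by fun_prop) hderiv ((hint.const_mul _).sub (hint'.const_mul _))
  rw [intervalIntegral.integral_sub (hint.const_mul _) (hint'.const_mul _),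
    intervalIntegral.integral_const_mul, intervalIntegral.integral_const_mul,
    sinExp_zero (by positivity), sinExp_zero (by positivity), sinExp_pi (by positivity),
    sinExp_pi (by positivity), add_assoc, one_add_one_eq_two] at key
  simpa only [sinExpIntegral, mul_zero, sub_self, sub_eq_zero] using key

theorem sinExpIntegral_zero_right (s : ℝ) :
    sinExpIntegral s 0 = ((∫ θ in (0 : ℝ)..π, Real.sin θ ^ s : ℝ) : ℂ) := by
  simp [sinExpIntegral, sinExp, intervalIntegral.integral_ofReal]

theorem sinExpIntegral_zero_right_ne_zero {s : ℝ} (hs : 0 ≤ s) : sinExpIntegral s 0 ≠ 0 := by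
  have hcont : Continuous fun θ : ℝ => Real.sin θ ^ s :=
    Real.continuous_sin.rpow_const fun _ => Or.inr hs
  have hpos : 0 < ∫ θ in (0 : ℝ)..π, Real.sin θ ^ s :=
    intervalIntegral.intervalIntegral_pos_of_pos_on (hcont.intervalIntegrable _ _)
      (fun θ hθ => Real.rpow_pos_of_pos (Real.sin_pos_of_mem_Ioo hθ) s) Real.pi_pos
  rw [sinExpIntegral_zero_right]
  exact_mod_cast hpos.ne'

theorem sinExpIntegral_add_two_mul (s : ℝ) (y : ℂ) (j : ℕ) :
    sinExpIntegral (s + 2 * j) y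
      = ∫ θ in Icc 0 π, (Real.sin θ ^ 2) ^ j • sinExp s y θ := by
  rw [sinExpIntegral, intervalIntegral.integral_of_le Real.pi_pos.le, integral_Icc_eq_integral_Ioo,
    integral_Ioc_eq_integral_Ioo]
  refine setIntegral_congr_fun measurableSet_Ioo fun θ hθ => ?_
  have hpow : Real.sin θ ^ (s + 2 * (j : ℝ)) = (Real.sin θ ^ 2) ^ j * Real.sin θ ^ s := by
    rw [← pow_mul, mul_comm (Real.sin θ ^ _),
      ← Real.rpow_add_natCast (Real.sin_pos_of_mem_Ioo hθ).ne']
    push_cast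
    rfl
  simp only [sinExp, hpow, Complex.real_smul]
  push_cast
  ring

-- The weights `sin^{2j}` concentrate at `π/2`, where the exponential equals `1`.
theorem tendsto_sinExpIntegral_div {s : ℝ} (hs : 0 ≤ s) (y : ℂ) :
    Tendsto (fun j : ℕ => sinExpIntegral (s + 2 * j) y / sinExpIntegral (s + 2 * j) 0)
      atTop (𝓝 1) := by
  have hpeak (z : ℂ) : Tendsto (fun j : ℕ => (∫ θ in Icc 0 π, (Real.sin θ ^ 2) ^ j)⁻¹ •
      sinExpIntegral (s + 2 * j) z) atTop (𝓝 1) := by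
    have hmid : sinExp s z (π / 2) = 1 := by simp [sinExp]
    have hlt (θ : ℝ) (hθ : θ ∈ Icc 0 π) (hne : θ ≠ π / 2) :
        Real.sin θ ^ 2 < Real.sin (π / 2) ^ 2 := by
      have hcos : Real.cos θ ≠ 0 := fun h => hne <| Real.injOn_cos hθ
        ⟨by positivity, by linarith [Real.pi_pos]⟩ (h.trans Real.cos_pi_div_two.symm)
      have := Real.sin_sq_add_cos_sq θ
      have := pow_pos (abs_pos.2 hcos) 2
      rw [sq_abs] at this
      rw [Real.sin_pi_div_two]
      linarith
    simp only [sinExpIntegral_add_two_mul s]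
    rw [← hmid]
    refine tendsto_setIntegral_pow_smul_of_unique_maximum_of_isCompact_of_continuousOn
      isCompact_Icc (by fun_prop) hlt (fun θ _ => sq_nonneg _) (by simp) ?_
      (continuous_sinExp hs z).continuousOn
    rw [interior_Icc, closure_Ioo Real.pi_pos.ne]
    exact ⟨by positivity, by linarith [Real.pi_pos]⟩
  have hratio := (hpeak y).div (hpeak 0) one_ne_zero
  rw [div_one] at hratio
  refine hratio.congr fun j => ?_
  have hpos : 0 < ∫ θ in Icc 0 π, (Real.sin θ ^ 2) ^ j := by
    simp only [← pow_mul]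
    rw [integral_Icc_eq_integral_Ioc, ← intervalIntegral.integral_of_le Real.pi_pos.le]
    exact integral_sin_pow_pos _
  rw [Pi.div_apply, Complex.real_smul, Complex.real_smul, mul_div_mul_left]
  exact_mod_cast (inv_pos.2 hpos).ne'

-- Iterate the recursion, comparing the parameters `y = 2w` and `0`.
theorem sinExpIntegral_mul_eq_prod {s : ℝ} (hs : 0 ≤ s) (w : ℂ) (N : ℕ) :
    sinExpIntegral s (2 * w) / sinExpIntegral s 0
      = sinExpIntegral (s + 2 * N) (2 * w) / sinExpIntegral (s + 2 * N) 0
        * ∏ j ∈ Finset.range N,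
          ((s / 2 + 1 + w + j) * (s / 2 + 1 - w + j) / (s / 2 + 1 + j) ^ 2) := by
  induction N with
  | zero => simp
  | succ N ih =>
    have hN : 0 ≤ s + 2 * (N : ℝ) := by positivity
    have hstep := sinExpIntegral_add_two hN (2 * w)
    have hstep₀ := sinExpIntegral_add_two hN 0
    have hne := sinExpIntegral_zero_right_ne_zero hN
    have hne' := sinExpIntegral_zero_right_ne_zero (s := s + 2 * (N : ℝ) + 2) (by positivity)
    have hden : (s / 2 + 1 + N : ℂ) ≠ 0 := by
      have : (0 : ℝ) < s / 2 + 1 + N := by positivity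
      exact_mod_cast this.ne'
    have hcast : s + 2 * ((N + 1 : ℕ) : ℝ) = s + 2 * N + 2 := by push_cast; ring
    rw [ih, Finset.prod_range_succ, hcast, mul_comm (∏ _ ∈ _, _), ← mul_assoc]
    congr 1
    rw [div_mul_div_comm, div_eq_div_iff hne (mul_ne_zero hne' (pow_ne_zero 2 hden))]
    push_cast at hstep hstep₀
    linear_combination (1 / 4) * sinExpIntegral (s + 2 * N) (2 * w) * hstep₀
      - (1 / 4) * sinExpIntegral (s + 2 * N) 0 * hstep

theorem tendsto_inv_GammaSeq (z : ℂ) :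
    Tendsto (fun n => (Complex.GammaSeq z n)⁻¹) atTop (𝓝 (Complex.Gamma z)⁻¹) := by
  by_cases hz : Complex.Gamma z = 0
  · obtain ⟨m, rfl⟩ := (Complex.Gamma_eq_zero_iff z).1 hz
    rw [hz]
    refine tendsto_const_nhds.congr' ?_
    filter_upwards [eventually_ge_atTop m] with n hn
    rw [Complex.GammaSeq, Finset.prod_eq_zero (Finset.mem_range.2 (Nat.lt_succ_of_le hn))
      (neg_add_cancel _), div_zero, inv_zero]
  · exact (Complex.GammaSeq_tendsto_Gamma z).inv₀ hz

theorem tendsto_prod_add_mul_sub_div_sq (a w : ℂ) :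
    Tendsto (fun N : ℕ => ∏ j ∈ Finset.range N, ((a + w + j) * (a - w + j) / (a + j) ^ 2)) atTop
      (𝓝 (Complex.Gamma a ^ 2 / (Complex.Gamma (a + w) * Complex.Gamma (a - w)))) := by
  have hlim := ((Complex.GammaSeq_tendsto_Gamma a).pow 2).mul
    ((tendsto_inv_GammaSeq (a + w)).mul (tendsto_inv_GammaSeq (a - w)))
  rw [← mul_inv, ← div_eq_mul_inv] at hlim
  refine (tendsto_add_atTop_iff_nat 1).1 (hlim.congr' ?_)
  filter_upwards [eventually_ne_atTop 0] with n hn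
  have hn' : (n : ℂ) ≠ 0 := Nat.cast_ne_zero.2 hn
  have hfac : (n.factorial : ℂ) ≠ 0 := Nat.cast_ne_zero.2 n.factorial_ne_zero
  have ha : (n : ℂ) ^ a ≠ 0 := by simp [Complex.cpow_eq_zero_iff, hn]
  have hw : (n : ℂ) ^ w ≠ 0 := by simp [Complex.cpow_eq_zero_iff, hn]
  rw [Finset.prod_div_distrib, Finset.prod_mul_distrib, Finset.prod_pow, Complex.GammaSeq,
    Complex.GammaSeq, Complex.GammaSeq, Complex.cpow_add _ _ hn', Complex.cpow_sub _ _ hn']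
  field_simp

theorem sinExpIntegral_div_zero_right {s : ℝ} (hs : 0 ≤ s) (w : ℂ) :
    sinExpIntegral s (2 * w) / sinExpIntegral s 0 = Complex.Gamma (s / 2 + 1) ^ 2
      / (Complex.Gamma (s / 2 + 1 + w) * Complex.Gamma (s / 2 + 1 - w)) := by
  have hlim := (tendsto_sinExpIntegral_div hs (2 * w)).mul
    (tendsto_prod_add_mul_sub_div_sq (s / 2 + 1) w)
  rw [one_mul] at hlim
  exact tendsto_nhds_unique
    (tendsto_const_nhds.congr fun N => sinExpIntegral_mul_eq_prod hs w N) hlim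

-- The substitution `t = (1 - cos θ) / 2`.
theorem betaIntegral_self_eq_sinExpIntegral (s : ℝ) :
    Complex.betaIntegral ((s + 1) / 2) ((s + 1) / 2)
      = ((2 ^ (-s) : ℝ) : ℂ) * sinExpIntegral s 0 := by
  have hsubst := intervalIntegral.integral_deriv_smul_comp_of_deriv_nonneg (a := 0) (b := π)
    (f := fun θ => (1 - Real.cos θ) / 2) (f' := fun θ => Real.sin θ / 2)
    (g := fun t : ℝ => (t : ℂ) ^ ((s + 1) / 2 - 1 : ℂ) * (1 - (t : ℂ)) ^ ((s + 1) / 2 - 1 : ℂ))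
    (by fun_prop)
    (fun θ _ => by simpa using ((Real.hasDerivAt_cos θ).const_sub 1).div_const 2)
    (fun θ hθ => by
      rw [min_eq_left Real.pi_pos.le, max_eq_right Real.pi_pos.le] at hθ
      exact div_nonneg (Real.sin_pos_of_mem_Ioo hθ).le zero_le_two)
  simp only [Real.cos_zero, Real.cos_pi, sub_self, zero_div, sub_neg_eq_add, one_add_one_eq_two,
    div_self (two_ne_zero' ℝ)] at hsubst
  rw [Complex.betaIntegral, ← hsubst, sinExpIntegral_zero_right, ← Complex.ofReal_mul,
    ← intervalIntegral.integral_const_mul, ← intervalIntegral.integral_ofReal,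
    intervalIntegral.integral_of_le Real.pi_pos.le, intervalIntegral.integral_of_le Real.pi_pos.le,
    integral_Ioc_eq_integral_Ioo, integral_Ioc_eq_integral_Ioo]
  refine setIntegral_congr_fun measurableSet_Ioo fun θ hθ => ?_
  have hsin : 0 < Real.sin θ / 2 := half_pos (Real.sin_pos_of_mem_Ioo hθ)
  have hleft : 0 ≤ (1 - Real.cos θ) / 2 := by linarith [Real.cos_le_one θ]
  have hright : 0 ≤ 1 - (1 - Real.cos θ) / 2 := by linarith [Real.neg_one_le_cos θ]
  have hprod : (1 - Real.cos θ) / 2 * (1 - (1 - Real.cos θ) / 2) = (Real.sin θ / 2) ^ (2 : ℝ) := by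
    rw [Real.rpow_two]
    linear_combination (-1 / 4) * Real.sin_sq_add_cos_sq θ
  have hexp : ((s : ℂ) + 1) / 2 - 1 = (((s + 1) / 2 - 1 : ℝ) : ℂ) := by push_cast; rfl
  simp only [Function.comp_apply, Complex.real_smul, hexp]
  rw [← Complex.ofReal_one, ← Complex.ofReal_sub, ← Complex.ofReal_cpow hleft,
    ← Complex.ofReal_cpow hright, ← Complex.ofReal_mul, ← Complex.ofReal_mul,
    ← Real.mul_rpow hleft hright, hprod, ← Real.rpow_mul hsin.le, mul_comm,
    ← Real.rpow_add_one hsin.ne', show 2 * ((s + 1) / 2 - 1) + 1 = s by ring,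
    Real.div_rpow (Real.sin_pos_of_mem_Ioo hθ).le zero_le_two, Real.rpow_neg zero_le_two,
    div_eq_inv_mul]

-- Legendre's duplication formula turns the beta integral into this form.
theorem sinExpIntegral_zero_right_mul_Gamma_sq {s : ℝ} (hs : -1 < s) :
    sinExpIntegral s 0 * Complex.Gamma (s / 2 + 1) ^ 2
      = π * ((2 ^ (-s) : ℝ) : ℂ) * Complex.Gamma (s + 1) := by
  have hre : 0 < (((s : ℂ) + 1) / 2).re := by
    have : (((s : ℂ) + 1) / 2).re = (s + 1) / 2 := by simp
    linarith
  have hbeta := Complex.Gamma_mul_Gamma_eq_betaIntegral hre hre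
  have hdup := Complex.Gamma_mul_Gamma_add_half (((s : ℂ) + 1) / 2)
  have hpow : (2 : ℂ) ^ (1 - ((s : ℂ) + 1)) = ((2 ^ (-s) : ℝ) : ℂ) := by
    rw [Complex.ofReal_cpow zero_le_two]
    push_cast
    ring_nf
  have hpow_ne : ((2 ^ (-s) : ℝ) : ℂ) ≠ 0 := by
    exact_mod_cast (Real.rpow_pos_of_pos two_pos (-s)).ne'
  have hGamma_ne : Complex.Gamma (s + 1) ≠ 0 :=
    Complex.Gamma_ne_zero_of_re_pos (by simpa using neg_lt_iff_pos_add.1 hs)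
  have hpi : ((√π : ℝ) : ℂ) ^ 2 = π := by exact_mod_cast Real.sq_sqrt Real.pi_pos.le
  rw [betaIntegral_self_eq_sinExpIntegral, add_halves] at hbeta
  rw [mul_div_cancel₀ _ two_ne_zero, hpow, show ((s : ℂ) + 1) / 2 + 1 / 2 = s / 2 + 1 by ring]
    at hdup
  refine mul_left_cancel₀ (mul_ne_zero hGamma_ne hpow_ne) ?_
  calc _ = Complex.Gamma (s + 1) * (((2 ^ (-s) : ℝ) : ℂ) * sinExpIntegral s 0)
        * Complex.Gamma (s / 2 + 1) ^ 2 := by ring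
    _ = (Complex.Gamma ((s + 1) / 2) * Complex.Gamma (s / 2 + 1)) ^ 2 := by rw [← hbeta]; ring
    _ = _ := by rw [hdup, mul_pow, hpi]; ring

theorem sinExpIntegral_eq {s : ℝ} (hs : 0 ≤ s) (w : ℂ) :
    sinExpIntegral s (2 * w) = π * ((2 ^ (-s) : ℝ) : ℂ) * Complex.Gamma (s + 1)
      / (Complex.Gamma (s / 2 + 1 + w) * Complex.Gamma (s / 2 + 1 - w)) := by
  have h := sinExpIntegral_div_zero_right hs w
  rw [div_eq_iff (sinExpIntegral_zero_right_ne_zero hs)] at h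
  rw [h, ← sinExpIntegral_zero_right_mul_Gamma_sq (by linarith)]
  ring

end CauchyIntegral

section Jacobi

open Polynomial

theorem ascPochhammer_succ_eval_left {S : Type*} [CommSemiring S] (n : ℕ) (z : S) :
    (ascPochhammer S (n + 1)).eval z = z * (ascPochhammer S n).eval (z + 1) := by
  simp [ascPochhammer_succ_left]

/-- The Jacobi polynomial `P_n^{(a,b)}` in the variable `(z - 1) / 2`, in which its coefficients
are explicit. -/
noncomputable def jacobiShifted (n : ℕ) (a b : ℂ) : ℂ[X] :=
  ∑ k ∈ Finset.range (n + 1),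
    C ((ascPochhammer ℂ k).eval (n + a + b + 1) * (ascPochhammer ℂ (n - k)).eval (a + k + 1)
      / ((k.factorial : ℂ) * ((n - k).factorial : ℂ))) * X ^ k

theorem jacobiShifted_eval (n : ℕ) (a b z : ℂ) :
    (jacobiShifted n a b).eval ((z - 1) / 2) = jacobiP n a b z := by
  simp [jacobiShifted, jacobiP, eval_finsetSum]

theorem jacobiShifted_coeff (n : ℕ) (a b : ℂ) (k : ℕ) :
    (jacobiShifted n a b).coeff k = if k ≤ n then
      (ascPochhammer ℂ k).eval (n + a + b + 1) * (ascPochhammer ℂ (n - k)).eval (a + k + 1)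
      / ((k.factorial : ℂ) * ((n - k).factorial : ℂ)) else 0 := by
  simp only [jacobiShifted, finsetSum_coeff, coeff_C_mul, coeff_X_pow, mul_ite, mul_one, mul_zero,
    Finset.sum_ite_eq, Finset.mem_range, Nat.lt_succ_iff]

theorem natDegree_jacobiShifted_le (n : ℕ) (a b : ℂ) : (jacobiShifted n a b).natDegree ≤ n := by
  rw [natDegree_le_iff_coeff_eq_zero]
  intro k hk
  rw [jacobiShifted_coeff, if_neg (by lia)]

theorem jacobiShifted_coeff_succ (n : ℕ) (a b : ℂ) (k : ℕ) :
    ((k : ℂ) + 1) * (a + k + 1) * (jacobiShifted n a b).coeff (k + 1)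
      = (n + a + b + 1 + k) * ((n : ℂ) - k) * (jacobiShifted n a b).coeff k := by
  rw [jacobiShifted_coeff, jacobiShifted_coeff]
  rcases lt_trichotomy k n with hkn | rfl | hkn
  · obtain ⟨d, rfl⟩ := Nat.exists_eq_add_of_lt hkn
    rw [if_pos (by lia), if_pos (by lia), show k + d + 1 - (k + 1) = d by lia,
      show k + d + 1 - k = d + 1 by lia, ascPochhammer_succ_eval, ascPochhammer_succ_eval_left,
      Nat.factorial_succ, Nat.factorial_succ]
    have hk : ((k.factorial : ℕ) : ℂ) ≠ 0 := Nat.cast_ne_zero.2 k.factorial_ne_zero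
    have hd : ((d.factorial : ℕ) : ℂ) ≠ 0 := Nat.cast_ne_zero.2 d.factorial_ne_zero
    have hk' : ((k : ℂ) + 1) ≠ 0 := Nat.cast_add_one_ne_zero k
    have hd' : ((d : ℂ) + 1) ≠ 0 := Nat.cast_add_one_ne_zero d
    push_cast
    rw [show a + ((k : ℂ) + 1) + 1 = a + k + 1 + 1 by ring]
    field_simp
    ring
  · simp
  · simp [hkn.not_ge, (hkn.trans k.lt_succ_self).not_ge]

theorem jacobiShifted_ode (n : ℕ) (a b : ℂ) :
    X * (X + 1) * derivative (derivative (jacobiShifted n a b))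
      + (C (a + b + 2) * X + C (a + 1)) * derivative (jacobiShifted n a b)
      = C ((n : ℂ) * (n + a + b + 1)) * jacobiShifted n a b := by
  have hexpand : X * (X + 1) * derivative (derivative (jacobiShifted n a b))
      + (C (a + b + 2) * X + C (a + 1)) * derivative (jacobiShifted n a b)
      = X * (X * derivative (derivative (jacobiShifted n a b)))
        + X * derivative (derivative (jacobiShifted n a b))
        + C (a + b + 2) * (X * derivative (jacobiShifted n a b))
        + C (a + 1) * derivative (jacobiShifted n a b) := by ring
  rw [hexpand]
  ext k
  have hrec := jacobiShifted_coeff_succ n a b k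
  rcases k with _ | _ | k <;>
  · simp only [coeff_add, coeff_C_mul, coeff_X_mul, mul_coeff_zero, coeff_X_zero, coeff_C_zero,
      coeff_derivative]
    push_cast at hrec ⊢
    linear_combination hrec

/-- The polynomial `P_n^{(a,b)}(i X)`. -/
noncomputable def jacobiImag (n : ℕ) (a b : ℂ) : ℂ[X] :=
  (jacobiShifted n a b).comp (C (Complex.I / 2) * X - C (1 / 2))

theorem jacobiImag_eval (n : ℕ) (a b z : ℂ) :
    (jacobiImag n a b).eval z = jacobiP n a b (Complex.I * z) := by
  rw [← jacobiShifted_eval, jacobiImag, eval_comp]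
  congr 1
  simp only [eval_sub, eval_mul, eval_C, eval_X]
  ring

theorem natDegree_jacobiImag_le (n : ℕ) (a b : ℂ) : (jacobiImag n a b).natDegree ≤ n := by
  have hlinear : (C (Complex.I / 2) * X - C (1 / 2) : ℂ[X]).natDegree ≤ 1 := by
    rw [sub_eq_add_neg, ← C_neg]
    exact natDegree_linear_le
  exact natDegree_comp_le.trans
    ((Nat.mul_le_mul (natDegree_jacobiShifted_le n a b) hlinear).trans_eq (mul_one n))

theorem jacobiImag_eval_neg_I (n : ℕ) (a b : ℂ) :
    (jacobiImag n a b).eval (-Complex.I) = (ascPochhammer ℂ n).eval (a + 1) / n.factorial := by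
  have hone : Complex.I * -Complex.I = 1 := by simp
  rw [jacobiImag_eval, hone, ← jacobiShifted_eval, sub_self, zero_div, ← coeff_zero_eq_eval_zero,
    jacobiShifted_coeff, if_pos n.zero_le]
  simp

theorem jacobiImag_ode (n : ℕ) (a b : ℂ) :
    (1 + X ^ 2) * derivative (derivative (jacobiImag n a b))
      + (C (a + b + 2) * X + C (Complex.I * (b - a))) * derivative (jacobiImag n a b)
      = C ((n : ℂ) * (n + a + b + 1)) * jacobiImag n a b := by
  refine Polynomial.funext fun z => ?_
  have hode := congrArg (eval (Complex.I / 2 * z - 1 / 2)) (jacobiShifted_ode n a b)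
  simp only [jacobiImag, derivative_comp, derivative_mul, derivative_sub, derivative_C,
    derivative_X, eval_add, eval_sub, eval_mul, eval_pow, eval_comp, eval_C, eval_X, eval_one,
    zero_mul, zero_add, mul_one, sub_zero] at hode ⊢
  set J'' := (derivative (derivative (jacobiShifted n a b))).eval (Complex.I / 2 * z - 1 / 2)
  set J' := (derivative (jacobiShifted n a b)).eval (Complex.I / 2 * z - 1 / 2)
  linear_combination hode + (J'' / 4 + (b - a) / 2 * J') * Complex.I_sq

end Jacobi

section CotDeriv

open Polynomial

variable {A : Type*} [CommRing A]

/-- The derivative written in the variable `X = cot θ`: if `G' = g(cot)`, then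
`(e^G R(cot))' = e^G (cotDeriv g R)(cot)`. -/
noncomputable def cotDeriv (g R : A[X]) : A[X] := g * R - (1 + X ^ 2) * derivative R

theorem cotDeriv_C_mul (g : A[X]) (c : A) (R : A[X]) :
    cotDeriv g (C c * R) = C c * cotDeriv g R := by
  simp only [cotDeriv, derivative_C_mul]
  ring

/-- A first-order factorisation `(∂ + h)(∂ - h)` of a Schrödinger operator; replacing `h` by `-h`
gives its superpartner. -/
theorem cotDeriv_add_cotDeriv_sub (g h R : A[X]) :
    cotDeriv (g + h) (cotDeriv (g - h) R)
      = cotDeriv g (cotDeriv g R) - (h ^ 2 - (1 + X ^ 2) * derivative h) * R := by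
  simp only [cotDeriv, derivative_sub, derivative_mul, derivative_add, derivative_one,
    derivative_X_pow]
  ring

theorem cotDeriv_sub_cotDeriv_add (g h R : A[X]) :
    cotDeriv (g - h) (cotDeriv (g + h) R)
      = cotDeriv g (cotDeriv g R) - (h ^ 2 + (1 + X ^ 2) * derivative h) * R := by
  simpa [← sub_eq_add_neg] using cotDeriv_add_cotDeriv_sub g (-h) R

theorem natDegree_one_add_X_sq_le : (1 + X ^ 2 : A[X]).natDegree ≤ 2 := by
  compute_degree

theorem natDegree_cotDeriv_le {g R : A[X]} {d : ℕ} (hg : g.natDegree ≤ 1) (hR : R.natDegree ≤ d) :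
    (cotDeriv g R).natDegree ≤ d + 1 := by
  refine natDegree_sub_le_iff_left ?_ |>.2
    (natDegree_mul_le_of_le hg hR |>.trans_eq (add_comm 1 d))
  rcases d with _ | d
  · rw [eq_C_of_natDegree_le_zero hR, derivative_C, mul_zero]
    simp
  · exact natDegree_mul_le_of_le natDegree_one_add_X_sq_le
      ((natDegree_derivative_le R).trans (Nat.sub_le_sub_right hR 1)) |>.trans (by lia)

theorem cotDeriv_coeff_succ {g R : A[X]} {d : ℕ} (hg : g.natDegree ≤ 1) (hR : R.natDegree ≤ d) :
    (cotDeriv g R).coeff (d + 1) = (g.coeff 1 - d) * R.coeff d := by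
  have hmul : (g * R).coeff (d + 1) = g.coeff 1 * R.coeff d := by
    rw [add_comm]
    exact coeff_mul_add_eq_of_natDegree_le hg hR
  rw [cotDeriv, coeff_sub, hmul]
  rcases d with _ | d
  · rw [eq_C_of_natDegree_le_zero hR, derivative_C, mul_zero]
    simp
  · have hR' : (derivative R).natDegree ≤ d :=
      (natDegree_derivative_le R).trans (Nat.sub_le_sub_right hR 1)
    have hcoeff : (1 + X ^ 2 : A[X]).coeff 2 = 1 := by simp [coeff_one]
    rw [show d + 1 + 1 = 2 + d by ring,
      coeff_mul_add_eq_of_natDegree_le natDegree_one_add_X_sq_le hR', hcoeff, coeff_derivative]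
    push_cast
    ring

end CotDeriv

namespace PoschlTeller

section Algebra

open Polynomial

variable {p : PoschlTeller}

/-- The exponent `n + ν + 1` of the sine in `φ_n`. -/
def expo (p : PoschlTeller) (n : ℕ) : ℝ := n + p.ν + 1

/-- The energy `E_n` in units of `ε₀`. -/
noncomputable def redEnergy (p : PoschlTeller) (n : ℕ) : ℝ := p.expo n ^ 2 - (p.β / p.expo n) ^ 2

/-- The logarithmic derivative of the ground state of level `k`, as a polynomial in the
cotangent. -/
noncomputable def groundPoly (p : PoschlTeller) (k : ℕ) : ℂ[X] :=
  C (p.expo k : ℂ) * X - C ((p.β / p.expo k : ℝ) : ℂ)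

/-- The potential of level `k` in units of `ε₀`, as a polynomial in the cotangent: it is the
original potential with `ν` replaced by `ν + k`. -/
noncomputable def potentialPoly (p : PoschlTeller) (k : ℕ) : ℂ[X] :=
  C (p.expo k * (p.expo k - 1) : ℂ) * (1 + X ^ 2) - C (2 * p.β : ℂ) * X

/-- The polynomial factor of `φ_n`. -/
noncomputable def eigenPoly (p : PoschlTeller) (n : ℕ) : ℂ[X] :=
  jacobiImag n (p.aParam n) (starRingEnd ℂ (p.aParam n))

/-- The polynomial factor of `A_{k-1} ⋯ A_0 φ_n`. -/
noncomputable def hierPoly (p : PoschlTeller) (n : ℕ) : ℕ → ℂ[X]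
  | 0 => p.eigenPoly n
  | k + 1 => cotDeriv (p.groundPoly n - p.groundPoly k) (hierPoly p n k)

theorem expo_pos (hν : -1 < p.ν) (n : ℕ) : 0 < p.expo n := by
  have : (0 : ℝ) ≤ n := n.cast_nonneg
  unfold expo
  linarith

theorem expo_succ (n : ℕ) : p.expo (n + 1) = p.expo n + 1 := by
  unfold expo
  push_cast
  ring

theorem groundPoly_sq (hν : -1 < p.ν) (k : ℕ) :
    p.groundPoly k ^ 2
      = C (p.expo k ^ 2 : ℂ) * (1 + X ^ 2) - C (2 * p.β : ℂ) * X - C (p.redEnergy k : ℂ) := by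
  have hβ : C (p.expo k : ℂ) * C ((p.β / p.expo k : ℝ) : ℂ) = C (p.β : ℂ) := by
    rw [← C_mul, ← Complex.ofReal_mul, mul_div_cancel₀ _ (expo_pos hν k).ne']
  simp only [groundPoly, redEnergy, Complex.ofReal_sub, Complex.ofReal_pow, C_sub, C_mul, C_pow,
    map_ofNat]
  linear_combination (-2 * X) * hβ

theorem derivative_groundPoly (k : ℕ) : derivative (p.groundPoly k) = C (p.expo k : ℂ) := by
  simp [groundPoly]

theorem groundPoly_riccati (hν : -1 < p.ν) (k : ℕ) :
    p.groundPoly k ^ 2 - (1 + X ^ 2) * derivative (p.groundPoly k)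
      = p.potentialPoly k - C (p.redEnergy k : ℂ) := by
  rw [groundPoly_sq hν, derivative_groundPoly, potentialPoly]
  simp only [C_sub, C_mul, C_pow, C_1]
  ring

/-- Shape invariance: the superpartner of level `k` is level `k + 1`. -/
theorem groundPoly_riccati_succ (hν : -1 < p.ν) (k : ℕ) :
    p.groundPoly k ^ 2 + (1 + X ^ 2) * derivative (p.groundPoly k)
      = p.potentialPoly (k + 1) - C (p.redEnergy k : ℂ) := by
  rw [groundPoly_sq hν, derivative_groundPoly, potentialPoly, expo_succ]
  simp only [C_add, C_sub, C_mul, C_pow, C_1, Complex.ofReal_add, Complex.ofReal_one]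
  ring

theorem aParam_eq (n : ℕ) :
    p.aParam n = -(p.expo n : ℂ) + Complex.I * ((p.β / p.expo n : ℝ) : ℂ) := by
  simp only [aParam, expo]
  push_cast
  ring

theorem conj_aParam (n : ℕ) :
    starRingEnd ℂ (p.aParam n) = -(p.expo n : ℂ) - Complex.I * ((p.β / p.expo n : ℝ) : ℂ) := by
  simp only [aParam_eq, map_add, map_neg, map_mul, Complex.conj_ofReal, Complex.conj_I]
  ring

theorem aParam_re (n : ℕ) : (p.aParam n).re = -p.expo n := by
  simp [aParam_eq]

theorem eigenPoly_ode (n : ℕ) :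
    (1 + X ^ 2) * derivative (derivative (p.eigenPoly n))
      = 2 * (p.groundPoly n - X) * derivative (p.eigenPoly n)
        + C ((n : ℂ) * (n - 2 * p.expo n + 1)) * p.eigenPoly n := by
  have hode := jacobiImag_ode n (p.aParam n) (starRingEnd ℂ (p.aParam n))
  have hsum : p.aParam n + starRingEnd ℂ (p.aParam n) = -2 * p.expo n := by
    rw [conj_aParam, aParam_eq]
    ring
  have hdiff : Complex.I * (starRingEnd ℂ (p.aParam n) - p.aParam n)
      = 2 * ((p.β / p.expo n : ℝ) : ℂ) := by
    rw [conj_aParam, aParam_eq]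
    linear_combination (-2 * ((p.β / p.expo n : ℝ) : ℂ)) * Complex.I_sq
  rw [add_assoc (n : ℂ), hsum, hdiff] at hode
  simp only [eigenPoly, groundPoly, C_add, C_mul, C_sub, C_neg, C_1, map_ofNat] at hode ⊢
  linear_combination hode

theorem cotDeriv_cotDeriv_eigenPoly (hν : -1 < p.ν) (n : ℕ) :
    cotDeriv (p.groundPoly n) (cotDeriv (p.groundPoly n) (p.eigenPoly n))
      = (p.potentialPoly 0 - C (p.redEnergy n : ℂ)) * p.eigenPoly n := by
  have hpot : p.potentialPoly 0
      = p.potentialPoly n + (1 + X ^ 2) * C ((n : ℂ) * (n - 2 * p.expo n + 1)) := by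
    have hcoeff : (p.expo 0 * (p.expo 0 - 1) : ℂ)
        = p.expo n * (p.expo n - 1) + (n : ℂ) * (n - 2 * p.expo n + 1) := by
      simp only [expo]
      push_cast
      ring
    rw [potentialPoly, hcoeff, C_add, potentialPoly]
    ring
  rw [hpot]
  simp only [cotDeriv, derivative_sub, derivative_mul, derivative_add, derivative_one,
    derivative_X_pow, Nat.cast_ofNat, map_ofNat]
  linear_combination p.eigenPoly n * groundPoly_riccati hν n + (1 + X ^ 2) * eigenPoly_ode n

theorem cotDeriv_hierPoly_succ_of_cotDeriv_cotDeriv (hν : -1 < p.ν) {n k : ℕ}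
    (h : cotDeriv (p.groundPoly n) (cotDeriv (p.groundPoly n) (p.hierPoly n k))
      = (p.potentialPoly k - C (p.redEnergy n : ℂ)) * p.hierPoly n k) :
    cotDeriv (p.groundPoly n + p.groundPoly k) (p.hierPoly n (k + 1))
      = C ((p.redEnergy k - p.redEnergy n : ℝ) : ℂ) * p.hierPoly n k := by
  rw [hierPoly, cotDeriv_add_cotDeriv_sub, groundPoly_riccati hν, h, Complex.ofReal_sub, C_sub]
  ring

/-- Up to scaling, the Schrödinger equation of level `k` for `A_{k-1} ⋯ A_0 φ_n`. -/
theorem cotDeriv_cotDeriv_hierPoly (hν : -1 < p.ν) (n k : ℕ) :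
    cotDeriv (p.groundPoly n) (cotDeriv (p.groundPoly n) (p.hierPoly n k))
      = (p.potentialPoly k - C (p.redEnergy n : ℂ)) * p.hierPoly n k := by
  induction k with
  | zero => exact cotDeriv_cotDeriv_eigenPoly hν n
  | succ k ih =>
    have hpartner :=
      cotDeriv_sub_cotDeriv_add (p.groundPoly n) (p.groundPoly k) (p.hierPoly n (k + 1))
    rw [cotDeriv_hierPoly_succ_of_cotDeriv_cotDeriv hν ih, cotDeriv_C_mul, ← hierPoly,
      groundPoly_riccati_succ hν, Complex.ofReal_sub, C_sub] at hpartner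
    linear_combination -hpartner

theorem cotDeriv_hierPoly_succ (hν : -1 < p.ν) (n k : ℕ) :
    cotDeriv (p.groundPoly n + p.groundPoly k) (p.hierPoly n (k + 1))
      = C ((p.redEnergy k - p.redEnergy n : ℝ) : ℂ) * p.hierPoly n k :=
  cotDeriv_hierPoly_succ_of_cotDeriv_cotDeriv hν (cotDeriv_cotDeriv_hierPoly hν n k)

theorem natDegree_groundPoly_le (k : ℕ) : (p.groundPoly k).natDegree ≤ 1 := by
  unfold groundPoly
  compute_degree

theorem groundPoly_coeff_one (k : ℕ) : (p.groundPoly k).coeff 1 = p.expo k := by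
  simp [groundPoly, coeff_C]

/-- Lowering shows that the top coefficient permitted by raising vanishes. -/
theorem natDegree_hierPoly_le (hν : -1 < p.ν) {n k : ℕ} (hk : k ≤ n) :
    (p.hierPoly n k).natDegree ≤ n - k := by
  induction k with
  | zero => exact natDegree_jacobiImag_le n _ _
  | succ k ih =>
    obtain ⟨d, rfl⟩ := Nat.exists_eq_add_of_le' hk
    have ih : (p.hierPoly (d + (k + 1)) k).natDegree ≤ d + 1 := (ih (by lia)).trans (by lia)
    set n := d + (k + 1) with hn
    have hsub : (p.groundPoly n - p.groundPoly k).natDegree ≤ 1 :=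
      natDegree_sub_le_of_le (natDegree_groundPoly_le n) (natDegree_groundPoly_le k)
    have hadd : (p.groundPoly n + p.groundPoly k).natDegree ≤ 1 :=
      natDegree_add_le_of_le (natDegree_groundPoly_le n) (natDegree_groundPoly_le k)
    have hexpo : p.expo n = p.expo k + d + 1 := by
      simp only [expo, hn]
      push_cast
      ring
    have htop : (p.hierPoly n (k + 1)).coeff (d + 2) = 0 := by
      rw [hierPoly, cotDeriv_coeff_succ hsub ih, coeff_sub, groundPoly_coeff_one,
        groundPoly_coeff_one, hexpo]
      push_cast
      ring
    have hdeg : (p.hierPoly n (k + 1)).natDegree ≤ d + 1 :=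
      natDegree_le_pred (natDegree_cotDeriv_le hsub ih) htop
    have hlow := congrArg (coeff · (d + 2)) (cotDeriv_hierPoly_succ hν n k)
    simp only [cotDeriv_coeff_succ hadd hdeg, coeff_C_mul, coeff_add, groundPoly_coeff_one,
      coeff_eq_zero_of_natDegree_lt (ih.trans_lt (Nat.lt_succ_self _)), mul_zero] at hlow
    have hfactor : (p.expo n + p.expo k - (d + 1 : ℕ) : ℂ) ≠ 0 := by
      rw [hexpo]
      have := (expo_pos hν k).ne'
      push_cast
      ring_nf
      exact_mod_cast mul_ne_zero this two_ne_zero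
    rw [show n - (k + 1) = d by lia]
    exact natDegree_le_pred hdeg ((mul_eq_zero.1 hlow).resolve_left hfactor)

theorem redEnergy_sub (hν : -1 < p.ν) (n k : ℕ) :
    p.redEnergy n - p.redEnergy k = (p.expo n - p.expo k) * (p.expo n + p.expo k)
      * (1 + p.β ^ 2 / (p.expo k * p.expo n) ^ 2) := by
  have hn := (expo_pos hν n).ne'
  have hk := (expo_pos hν k).ne'
  unfold redEnergy
  field_simp
  ring

theorem redEnergy_strictMono (hν : -1 < p.ν) : StrictMono p.redEnergy := by
  intro k n hkn
  rw [← sub_pos, redEnergy_sub hν]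
  have hn := expo_pos hν n
  have hk := expo_pos hν k
  have hsub : 0 < p.expo n - p.expo k := by
    have : (k : ℝ) < n := by exact_mod_cast hkn
    unfold expo
    linarith
  positivity

theorem ascPochhammer_aParam_ne_zero (hν : -1 < p.ν) {n k : ℕ} (hk : k ≤ n) :
    (ascPochhammer ℂ k).eval (p.aParam n + 1) ≠ 0 := by
  rw [Ne, ascPochhammer_eval_eq_zero_iff]
  rintro ⟨j, hj, h⟩
  have hre := congrArg Complex.re h
  simp only [Complex.natCast_re, Complex.neg_re, Complex.add_re, aParam_re, Complex.one_re,
    expo] at hre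
  have : (j : ℝ) + 1 ≤ n := by exact_mod_cast hj.trans_le hk
  linarith

theorem hierPoly_ne_zero (hν : -1 < p.ν) {n k : ℕ} (hk : k ≤ n) : p.hierPoly n k ≠ 0 := by
  induction k with
  | zero =>
    intro h
    have heval := jacobiImag_eval_neg_I n (p.aParam n) (starRingEnd ℂ (p.aParam n))
    rw [← eigenPoly, ← hierPoly, h, eval_zero, eq_comm, div_eq_zero_iff] at heval
    exact heval.elim (ascPochhammer_aParam_ne_zero hν le_rfl)
      (Nat.cast_ne_zero.2 n.factorial_ne_zero)
  | succ k ih =>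
    intro h
    have hlow := cotDeriv_hierPoly_succ hν n k
    rw [h, cotDeriv, derivative_zero, mul_zero, mul_zero, sub_zero, eq_comm, mul_eq_zero,
      C_eq_zero, Complex.ofReal_eq_zero, sub_eq_zero] at hlow
    exact hlow.elim (redEnergy_strictMono hν hk).ne (ih (by lia))

theorem exists_hierPoly_self_eq_C (hν : -1 < p.ν) (n : ℕ) :
    ∃ c : ℂ, c ≠ 0 ∧ p.hierPoly n n = C c := by
  have h := eq_C_of_natDegree_le_zero ((natDegree_hierPoly_le hν (le_refl n)).trans (by simp))
  exact ⟨_, fun h0 => hierPoly_ne_zero hν le_rfl (by rw [h, h0, C_0]), h⟩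

end Algebra

end PoschlTeller

section SinCotWave

open Polynomial

/-- The function `sin^a θ e^{-bθ} R(cot θ)`. -/
noncomputable def sinCotWave (a b : ℝ) (R : ℂ[X]) (θ : ℝ) : ℂ :=
  ((Real.sin θ ^ a : ℝ) : ℂ) * (Real.exp (-(b * θ)) : ℝ) * R.eval ((Real.cot θ : ℝ) : ℂ)

theorem hasDerivAt_cot {θ : ℝ} (h : Real.sin θ ≠ 0) :
    HasDerivAt Real.cot (-(1 + Real.cot θ ^ 2)) θ := by
  have hcot : Real.cot = fun y => Real.cos y / Real.sin y := funext Real.cot_eq_cos_div_sin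
  rw [hcot]
  refine ((Real.hasDerivAt_cos θ).div (Real.hasDerivAt_sin θ) h).congr_deriv ?_
  field_simp
  ring

theorem cot_mul_sin {θ : ℝ} (h : Real.sin θ ≠ 0) : Real.cot θ * Real.sin θ = Real.cos θ := by
  rw [Real.cot_eq_cos_div_sin, div_mul_cancel₀ _ h]

theorem hasDerivAt_sinCotWave (a b : ℝ) (R : ℂ[X]) {θ : ℝ} (h : 0 < Real.sin θ) :
    HasDerivAt (sinCotWave a b R)
      (sinCotWave a b (cotDeriv (C (a : ℂ) * X - C (b : ℂ)) R) θ) θ := by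
  have hsin := ((Real.hasDerivAt_sin θ).rpow_const (p := a) (Or.inl h.ne')).ofReal_comp
  have hexp := (((hasDerivAt_id θ).const_mul b).neg.exp).ofReal_comp
  have hcot := (R.hasDerivAt ((Real.cot θ : ℝ) : ℂ)).comp θ (hasDerivAt_cot h.ne').ofReal_comp
  refine ((hsin.mul hexp).mul hcot).congr_deriv ?_
  have hpow : Real.sin θ ^ a = Real.sin θ ^ (a - 1) * Real.sin θ := by
    rw [← Real.rpow_add_one h.ne', sub_add_cancel]
  simp only [sinCotWave, cotDeriv, hpow, ← cot_mul_sin h.ne', eval_sub, eval_mul, eval_add, eval_C,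
    eval_X, eval_one, eval_pow, Function.comp_apply, Pi.mul_apply, Pi.neg_apply, id]
  push_cast
  ring

theorem sinCotWave_C_mul (a b : ℝ) (c : ℂ) (R : ℂ[X]) (θ : ℝ) :
    sinCotWave a b (C c * R) θ = c * sinCotWave a b R θ := by
  simp only [sinCotWave, eval_mul, eval_C]
  ring

theorem exists_continuous_sinCotWave_eq {a s : ℝ} (b : ℝ) {R : ℂ[X]} {d : ℕ}
    (hR : R.natDegree ≤ d) (hs : s + d ≤ a) :
    ∃ g : ℝ → ℂ, Continuous g ∧
      ∀ θ, 0 < Real.sin θ → sinCotWave a b R θ = ((Real.sin θ ^ s : ℝ) : ℂ) * g θ := by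
  refine ⟨fun θ => ∑ j ∈ Finset.range (d + 1), R.coeff j *
    (((Real.sin θ ^ (a - s - j) : ℝ) : ℂ) * (Real.cos θ : ℂ) ^ j * (Real.exp (-(b * θ)) : ℝ)),
    continuous_finsetSum _ fun j hj => ?_, fun θ h => ?_⟩
  · have hj : (j : ℝ) ≤ d := by exact_mod_cast Finset.mem_range_succ_iff.1 hj
    have : Continuous fun θ : ℝ => Real.sin θ ^ (a - s - j) :=
      Real.continuous_sin.rpow_const fun θ => Or.inr (by linarith)
    fun_prop
  · rw [sinCotWave, eval_eq_sum_range' (Nat.lt_succ_of_le hR), Finset.mul_sum, Finset.mul_sum]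
    refine Finset.sum_congr rfl fun j _ => ?_
    have hpow : Real.sin θ ^ a
        = Real.sin θ ^ s * Real.sin θ ^ (a - s - j) * Real.sin θ ^ j := by
      rw [← Real.rpow_natCast, ← Real.rpow_add h, ← Real.rpow_add h]
      congr 1
      ring
    rw [hpow, ← cot_mul_sin h.ne']
    push_cast
    ring

end SinCotWave

namespace PoschlTeller

section PolyWave

open Polynomial

variable {p : PoschlTeller}

/-- The function `sin^{n+ν+1}(πx/L) exp(-βπx/(L(n+ν+1))) R(cot(πx/L))`. -/
noncomputable def polyWave (p : PoschlTeller) (n : ℕ) (R : ℂ[X]) (x : ℝ) : ℂ :=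
  sinCotWave (p.expo n) (p.β / p.expo n) R (Real.pi * x / p.L)

/-- On `(0, L)`, the function `f` is the product of `sin^s(πx/L)` and a function which is
continuous on `ℝ`. -/
def VanishesToOrder (p : PoschlTeller) (s : ℝ) (f : ℝ → ℂ) : Prop :=
  ∃ g : ℝ → ℂ, Continuous g ∧
    ∀ x ∈ Ioo 0 p.L, f x = ((Real.sin (Real.pi * x / p.L) ^ s : ℝ) : ℂ) * g x

theorem sin_pos_of_mem_Ioo {x : ℝ} (hx : x ∈ Ioo 0 p.L) : 0 < Real.sin (Real.pi * x / p.L) := by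
  have hL : 0 < p.L := hx.1.trans hx.2
  refine Real.sin_pos_of_pos_of_lt_pi (div_pos (mul_pos Real.pi_pos hx.1) hL) ?_
  rw [div_lt_iff₀ hL]
  exact mul_lt_mul_of_pos_left hx.2 Real.pi_pos

theorem hasDerivAt_polyWave (n : ℕ) (R : ℂ[X]) {x : ℝ} (hx : x ∈ Ioo 0 p.L) :
    HasDerivAt (p.polyWave n R)
      ((Real.pi / p.L : ℝ) * p.polyWave n (cotDeriv (p.groundPoly n) R) x) x := by
  have hθ : HasDerivAt (fun y : ℝ => Real.pi * y / p.L) (Real.pi / p.L) x := by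
    simpa using ((hasDerivAt_id x).const_mul Real.pi).div_const p.L
  exact (hasDerivAt_sinCotWave _ _ R (sin_pos_of_mem_Ioo hx)).scomp x hθ

theorem deriv_polyWave (n : ℕ) (R : ℂ[X]) {x : ℝ} (hx : x ∈ Ioo 0 p.L) :
    deriv (p.polyWave n R) x
      = (Real.pi / p.L : ℝ) * p.polyWave n (cotDeriv (p.groundPoly n) R) x :=
  (hasDerivAt_polyWave n R hx).deriv

theorem polyWave_C_mul (n : ℕ) (c : ℂ) (R : ℂ[X]) (x : ℝ) :
    p.polyWave n (C c * R) x = c * p.polyWave n R x :=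
  sinCotWave_C_mul _ _ c R _

theorem contDiffOn_polyWave (n : ℕ) (R : ℂ[X]) : ContDiffOn ℝ ∞ (p.polyWave n R) (Ioo 0 p.L) := by
  rw [contDiffOn_infty]
  intro k
  induction k generalizing R with
  | zero =>
    exact contDiffOn_zero.2 fun x hx => (hasDerivAt_polyWave n R hx).continuousAt.continuousWithinAt
  | succ k ih =>
    push_cast
    rw [contDiffOn_succ_iff_deriv_of_isOpen isOpen_Ioo]
    refine ⟨fun x hx => (hasDerivAt_polyWave n R hx).differentiableAt.differentiableWithinAt,
      by simp, ?_⟩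
    exact (contDiffOn_const.mul (ih (cotDeriv (p.groundPoly n) R))).congr
      fun x hx => deriv_polyWave n R hx

theorem vanishesToOrder_polyWave {n d : ℕ} {s : ℝ} {R : ℂ[X]} (hR : R.natDegree ≤ d)
    (hs : s + d ≤ p.expo n) : p.VanishesToOrder s (p.polyWave n R) := by
  obtain ⟨g, hg, h⟩ := exists_continuous_sinCotWave_eq (p.β / p.expo n) hR hs
  exact ⟨fun x => g (Real.pi * x / p.L), by fun_prop, fun x hx => h _ (sin_pos_of_mem_Ioo hx)⟩

namespace VanishesToOrder

variable {s : ℝ} {f : ℝ → ℂ}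

theorem const_mul (hf : p.VanishesToOrder s f) (c : ℂ) :
    p.VanishesToOrder s fun x => c * f x := by
  obtain ⟨g, hg, h⟩ := hf
  exact ⟨fun x => c * g x, continuous_const.mul hg, fun x hx => by simp only [h x hx]; ring⟩

theorem congr {f' : ℝ → ℂ} (hf : p.VanishesToOrder s f) (h : EqOn f' f (Ioo 0 p.L)) :
    p.VanishesToOrder s f' := by
  obtain ⟨g, hg, hfg⟩ := hf
  exact ⟨g, hg, fun x hx => (h hx).trans (hfg x hx)⟩

theorem exists_continuous_eqOn (hs : 0 ≤ s) (hf : p.VanishesToOrder s f) :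
    ∃ g : ℝ → ℂ, Continuous g ∧ EqOn f g (Ioo 0 p.L) ∧ (0 < s → p.L ≠ 0 → g 0 = 0 ∧ g p.L = 0) := by
  obtain ⟨g, hg, h⟩ := hf
  have hsin : Continuous fun x : ℝ => Real.sin (Real.pi * x / p.L) ^ s :=
    Continuous.rpow_const (by fun_prop) fun _ => Or.inr hs
  refine ⟨_, (Complex.continuous_ofReal.comp hsin).mul hg, h, fun hs hL => ?_⟩
  simp [hs.ne', hL]

theorem memL2 (hs : 0 ≤ s) (hf : p.VanishesToOrder s f) : p.MemL2 f := by
  obtain ⟨g, hg, h, -⟩ := hf.exists_continuous_eqOn hs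
  obtain ⟨K, hK⟩ := isCompact_Icc.exists_bound_of_continuousOn (hg.continuousOn (s := Icc 0 p.L))
  have hbound : ∀ᵐ x ∂volume.restrict (Ioo 0 p.L), ‖g x‖ ≤ K :=
    ae_restrict_of_forall_mem measurableSet_Ioo fun x hx => hK x (Ioo_subset_Icc_self hx)
  exact (memLp_congr_ae (ae_restrict_of_forall_mem measurableSet_Ioo h)).2
    (MemLp.of_bound hg.aestronglyMeasurable K hbound)

theorem tendsto_left (hL : 0 < p.L) (hs : 0 < s) (hf : p.VanishesToOrder s f) :
    Tendsto f (𝓝[>] 0) (𝓝 0) := by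
  obtain ⟨g, hg, h, hends⟩ := hf.exists_continuous_eqOn hs.le
  have ht : Tendsto g (𝓝[>] 0) (𝓝 (g 0)) := (hg.tendsto 0).mono_left nhdsWithin_le_nhds
  rw [(hends hs hL.ne').1] at ht
  exact ht.congr' (h.symm.eventuallyEq_of_mem (Ioo_mem_nhdsGT hL))

theorem tendsto_right (hL : 0 < p.L) (hs : 0 < s) (hf : p.VanishesToOrder s f) :
    Tendsto f (𝓝[<] p.L) (𝓝 0) := by
  obtain ⟨g, hg, h, hends⟩ := hf.exists_continuous_eqOn hs.le
  have ht : Tendsto g (𝓝[<] p.L) (𝓝 (g p.L)) := (hg.tendsto p.L).mono_left nhdsWithin_le_nhds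
  rw [(hends hs hL.ne').2] at ht
  exact ht.congr' (h.symm.eventuallyEq_of_mem (Ioo_mem_nhdsLT hL))

end VanishesToOrder

theorem locAC_of_contDiffOn {f : ℝ → ℂ} (hf : ContDiffOn ℝ 1 f (Ioo 0 p.L)) : p.LocAC f := by
  intro a b ha hab hb
  refine (hf.mono ?_).absolutelyContinuousOnInterval
  rw [uIcc_of_le hab.le]
  exact Icc_subset_Ioo ha hb

end PolyWave

end PoschlTeller

section AbsolutelyContinuous

theorem absolutelyContinuousOnInterval_comp_of_lipschitzWith {X Y : Type*} [PseudoMetricSpace X]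
    [PseudoMetricSpace Y] {K : NNReal} {φ : X → Y} (hφ : LipschitzWith K φ) {f : ℝ → X} {a b : ℝ}
    (hf : AbsolutelyContinuousOnInterval f a b) : AbsolutelyContinuousOnInterval (φ ∘ f) a b := by
  refine squeeze_zero (fun _ => Finset.sum_nonneg fun _ _ => dist_nonneg) (fun E => ?_)
    (by simpa using Tendsto.const_mul (K : ℝ) hf)
  rw [Finset.mul_sum]
  exact Finset.sum_le_sum fun i _ => hφ.dist_le_mul _ _

theorem intervalIntegrable_ofReal {f : ℝ → ℝ} {a b : ℝ} (hf : IntervalIntegrable f volume a b) :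
    IntervalIntegrable (fun x => (f x : ℂ)) volume a b :=
  ⟨hf.1.ofReal, hf.2.ofReal⟩

theorem integral_deriv_eq_sub_of_absolutelyContinuousOnInterval {f : ℝ → ℂ} {a b : ℝ}
    (hf : AbsolutelyContinuousOnInterval f a b) : ∫ x in a..b, deriv f x = f b - f a := by
  have hre : AbsolutelyContinuousOnInterval (fun x => (f x).re) a b :=
    absolutelyContinuousOnInterval_comp_of_lipschitzWith Complex.reCLM.lipschitz hf
  have him : AbsolutelyContinuousOnInterval (fun x => (f x).im) a b :=
    absolutelyContinuousOnInterval_comp_of_lipschitzWith Complex.imCLM.lipschitz hf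
  have hderiv : ∀ᵐ x, x ∈ uIoc a b → deriv f x
      = ((deriv (fun y => (f y).re) x : ℝ) : ℂ)
        + ((deriv (fun y => (f y).im) x : ℝ) : ℂ) * Complex.I := by
    filter_upwards [hf.boundedVariationOn.ae_differentiableAt_of_mem_uIcc] with x hx hx'
    have h := (hx (uIoc_subset_uIcc hx')).hasDerivAt
    have h_re : HasDerivAt (fun y => (f y).re) (deriv f x).re x :=
      Complex.reCLM.hasFDerivAt.comp_hasDerivAt x h
    have h_im : HasDerivAt (fun y => (f y).im) (deriv f x).im x :=
      Complex.imCLM.hasFDerivAt.comp_hasDerivAt x h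
    rw [h_re.deriv, h_im.deriv, Complex.re_add_im]
  rw [intervalIntegral.integral_congr_ae hderiv, intervalIntegral.integral_add
      (intervalIntegrable_ofReal hre.intervalIntegrable_deriv)
      ((intervalIntegrable_ofReal him.intervalIntegrable_deriv).mul_const _),
    intervalIntegral.integral_mul_const, intervalIntegral.integral_ofReal,
    intervalIntegral.integral_ofReal, hre.integral_deriv_eq_sub, him.integral_deriv_eq_sub]
  apply Complex.ext <;> simp

theorem exists_tendsto_of_sub_eq_intervalIntegral {E : Type*} [NormedAddCommGroup E]
    [NormedSpace ℝ E] {u h : ℝ → E} {a b : ℝ} (hab : a < b)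
    (hh : IntervalIntegrable h volume a b)
    (hu : ∀ x y, a < x → x < y → y < b → u y - u x = ∫ t in x..y, h t) :
    ∃ c d, Tendsto u (𝓝[>] a) (𝓝 c) ∧ Tendsto u (𝓝[<] b) (𝓝 d) ∧ d - c = ∫ t in a..b, h t := by
  obtain ⟨m, ham, hmb⟩ := exists_between hab
  have hF : ContinuousOn (fun x => u m + ∫ t in m..x, h t) (Icc a b) := by
    rw [← uIcc_of_le hab.le]
    refine continuousOn_const.add (intervalIntegral.continuousOn_primitive_interval' hh ?_)
    rw [uIcc_of_le hab.le]
    exact ⟨ham.le, hmb.le⟩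
  have huF : EqOn (fun x => u m + ∫ t in m..x, h t) u (Ioo a b) := by
    intro x hx
    rcases lt_trichotomy x m with hxm | rfl | hmx
    · simp only [intervalIntegral.integral_symm x m, ← hu x m hx.1 hxm hmb]
      abel
    · simp only [intervalIntegral.integral_same, add_zero]
    · simp only [← hu m x ham hmx hx.2, add_sub_cancel]
  have hleft := (hF a ⟨le_rfl, hab.le⟩).mono Ioo_subset_Icc_self
  have hright := (hF b ⟨hab.le, le_rfl⟩).mono Ioo_subset_Icc_self
  rw [ContinuousWithinAt, nhdsWithin_Ioo_eq_nhdsGT hab] at hleft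
  rw [ContinuousWithinAt, nhdsWithin_Ioo_eq_nhdsLT hab] at hright
  refine ⟨_, _, hleft.congr' (huF.eventuallyEq_of_mem (Ioo_mem_nhdsGT hab)),
    hright.congr' (huF.eventuallyEq_of_mem (Ioo_mem_nhdsLT hab)), ?_⟩
  rw [add_sub_add_left_eq_sub, intervalIntegral.integral_interval_sub_left] <;>
  · refine hh.mono_set (uIcc_subset_uIcc ?_ ?_) <;> simp [ham.le, hmb.le, hab.le]

theorem not_integrableOn_of_sub_inv_isBigO {F : Type*} [NormedAddCommGroup F] {f : ℝ → F} {c : ℝ}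
    {l : Filter ℝ} [l.NeBot] [TendstoIxxClass Icc l l] (hl : l ≤ 𝓝[≠] c) {s : Set ℝ} (hs : s ∈ l)
    (hf : (fun x => (x - c)⁻¹) =O[l] f) : ¬IntegrableOn f s := by
  have hderiv : ∀ᶠ x in l, HasDerivAt (fun x => Real.log (x - c)) (x - c)⁻¹ x := by
    filter_upwards [hl self_mem_nhdsWithin] with x hx
    simpa using ((hasDerivAt_id x).sub_const c).log (sub_ne_zero.2 hx)
  have hlog : Tendsto (fun x => ‖Real.log (x - c)‖) (𝓝[≠] c) atTop := by
    refine tendsto_abs_atBot_atTop.comp (Real.tendsto_log_nhdsNE_zero.comp ?_)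
    rw [← sub_self c]
    exact ((hasDerivAt_id c).sub_const c).tendsto_nhdsNE one_ne_zero
  exact not_integrableOn_of_tendsto_norm_atTop_of_deriv_isBigO_filter l hs
    (hderiv.mono fun x hx => hx.differentiableAt) (hlog.mono_left hl)
    (hf.congr' (hderiv.mono fun x hx => hx.deriv.symm) EventuallyEq.rfl)

theorem eq_zero_of_tendsto_of_integrableOn_div {l : Filter ℝ} [l.NeBot] [TendstoIxxClass Icc l l]
    {c φ' : ℝ} (hl : l ≤ 𝓝[≠] c) {s : Set ℝ} (hs : s ∈ l) {φ : ℝ → ℝ} (hφ : HasDerivAt φ φ' c)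
    (hφc : φ c = 0) (hφ0 : ∀ᶠ x in l, φ x ≠ 0) {v : ℝ → ℂ} {K : ℂ} (hv : Tendsto v l (𝓝 K))
    (hi : IntegrableOn (fun x => v x / (φ x : ℂ)) s) : K = 0 := by
  by_contra hK
  refine not_integrableOn_of_sub_inv_isBigO hl hs ?_ hi
  have hφO : φ =O[l] fun x => x - c := by
    simpa only [hφc, sub_zero] using hφ.isBigO_sub.mono (hl.trans nhdsWithin_le_nhds)
  have hinv : (fun x => (x - c)⁻¹) =O[l] fun x => ((φ x : ℂ))⁻¹ :=
    (hφO.inv_rev (hφ0.mono fun x hx h => absurd h hx)).trans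
      (Asymptotics.isBigO_of_le l fun x => by simp)
  have hv1 : (fun _ => (1 : ℝ)) =O[l] v :=
    (Asymptotics.isBigO_const_const 1 hK l).trans
      ((Asymptotics.isEquivalent_const_iff_tendsto hK).2 hv).symm.isBigO
  simpa only [div_eq_mul_inv, one_mul] using hv1.mul hinv

end AbsolutelyContinuous

namespace PoschlTeller

section AdjointDomain

variable {p : PoschlTeller}

theorem integrableOn_conj_mul {u v : ℝ → ℂ} (hu : p.MemL2 u) (hv : p.MemL2 v) :
    IntegrableOn (fun x => starRingEnd ℂ (u x) * v x) (Ioo 0 p.L) :=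
  hu.star.integrable_mul hv

theorem conj_mul_sub_eq_intervalIntegral {k : ℕ} {ψ f : ℝ → ℂ}
    (hW : ∀ x ∈ Ioo 0 p.L, starRingEnd ℂ (p.superpot k x) = p.superpot k x)
    (hψ : p.LocAC ψ) (hf : p.LocAC f) {a b : ℝ} (ha : 0 < a) (hab : a < b) (hb : b < p.L) :
    (p.ħ : ℂ) * starRingEnd ℂ (ψ b) * f b - (p.ħ : ℂ) * starRingEnd ℂ (ψ a) * f a
      = ∫ x in a..b,
          (starRingEnd ℂ (p.opA k ψ x) * f x - starRingEnd ℂ (ψ x) * p.opAdag k f x) := by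
  have hψab := hψ a b ha hab hb
  have hfab := hf a b ha hab hb
  have hconj : AbsolutelyContinuousOnInterval (fun x => starRingEnd ℂ (ψ x)) a b :=
    absolutelyContinuousOnInterval_comp_of_lipschitzWith Complex.isometry_conj.lipschitz hψab
  have hftc : ∫ x in a..b, deriv (fun y => starRingEnd ℂ (ψ y) * f y) x
      = starRingEnd ℂ (ψ b) * f b - starRingEnd ℂ (ψ a) * f a :=
    integral_deriv_eq_sub_of_absolutelyContinuousOnInterval (hconj.smul hfab)
  rw [mul_assoc, mul_assoc, ← mul_sub, ← hftc, ← intervalIntegral.integral_const_mul]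
  refine intervalIntegral.integral_congr_ae ?_
  filter_upwards [hψab.boundedVariationOn.ae_differentiableAt_of_mem_uIcc,
    hfab.boundedVariationOn.ae_differentiableAt_of_mem_uIcc] with x hψx hfx hx
  have hxab : x ∈ uIcc a b := uIoc_subset_uIcc hx
  have hxL : x ∈ Ioo 0 p.L := Icc_subset_Ioo ha hb (uIcc_of_le hab.le ▸ hxab)
  have hprod := (hψx hxab).hasDerivAt.star.mul (hfx hxab).hasDerivAt
  change HasDerivAt (fun y => starRingEnd ℂ (ψ y) * f y)
    (starRingEnd ℂ (deriv ψ x) * f x + starRingEnd ℂ (ψ x) * deriv f x) x at hprod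
  simp only [hprod.deriv, opA, opAdag, map_add, map_mul, Complex.conj_ofReal, hW x hxL]
  ring

theorem exists_boundary_limits {k : ℕ} {ψ f : ℝ → ℂ} (hL : 0 < p.L)
    (hW : ∀ x ∈ Ioo 0 p.L, starRingEnd ℂ (p.superpot k x) = p.superpot k x)
    (hψ : p.MemDomA k ψ) (hf : p.LocAC f) (hf2 : p.MemL2 f) (hAf : p.MemL2 (p.opAdag k f)) :
    ∃ c d : ℂ,
      Tendsto (fun x => (p.ħ : ℂ) * starRingEnd ℂ (ψ x) * f x) (𝓝[>] 0) (𝓝 c) ∧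
      Tendsto (fun x => (p.ħ : ℂ) * starRingEnd ℂ (ψ x) * f x) (𝓝[<] p.L) (𝓝 d) ∧
      d - c = p.innerL2 (p.opA k ψ) f - p.innerL2 ψ (p.opAdag k f) := by
  obtain ⟨hψ2, hψac, hAψ⟩ := hψ
  have h₁ := integrableOn_conj_mul hAψ hf2
  have h₂ := integrableOn_conj_mul hψ2 hAf
  obtain ⟨c, d, hc, hd, hdc⟩ := exists_tendsto_of_sub_eq_intervalIntegral hL
    ((intervalIntegrable_iff_integrableOn_Ioo_of_le hL.le).2 (h₁.sub h₂))
    fun x y hx hxy hy => conj_mul_sub_eq_intervalIntegral hW hψac hf hx hxy hy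
  refine ⟨c, d, hc, hd, ?_⟩
  rw [hdc, innerL2, innerL2, ← integral_sub h₁ h₂, intervalIntegral.integral_of_le hL.le,
    integral_Ioc_eq_integral_Ioo]
  rfl

theorem boundary_limit_eq_zero {ψ f : ℝ → ℂ} (hψ : p.MemL2 ψ) (hf : p.VanishesToOrder 1 f)
    {l : Filter ℝ} [l.NeBot] [TendstoIxxClass Icc l l] {c K : ℂ} {x₀ : ℝ} (hl : l ≤ 𝓝[≠] x₀)
    (hIoo : Ioo 0 p.L ∈ l) (hx₀ : Real.sin (Real.pi * x₀ / p.L) = 0)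
    (hK : Tendsto (fun x => c * starRingEnd ℂ (ψ x) * f x) l (𝓝 K)) : K = 0 := by
  obtain ⟨g, hg, hfg⟩ := hf
  have hsin : Differentiable ℝ fun x => Real.sin (Real.pi * x / p.L) := by fun_prop
  have hg2 : p.MemL2 g :=
    VanishesToOrder.memL2 le_rfl ⟨g, hg, fun x _ => by rw [Real.rpow_zero]; simp⟩
  refine eq_zero_of_tendsto_of_integrableOn_div hl hIoo (hsin x₀).hasDerivAt hx₀
    (mem_of_superset hIoo fun x hx => (sin_pos_of_mem_Ioo hx).ne') hK ?_
  refine ((integrableOn_conj_mul hψ hg2).const_mul c).congr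
    (ae_restrict_of_forall_mem measurableSet_Ioo fun x hx => ?_)
  have hne : (Real.sin (Real.pi * x / p.L) : ℂ) ≠ 0 :=
    Complex.ofReal_ne_zero.2 (sin_pos_of_mem_Ioo hx).ne'
  simp only [hfg x hx, Real.rpow_one]
  field_simp

theorem memDomAdag_of_vanishesToOrder_one {k : ℕ} {f : ℝ → ℂ} (hL : 0 < p.L)
    (hW : ∀ x ∈ Ioo 0 p.L, starRingEnd ℂ (p.superpot k x) = p.superpot k x)
    (hf : p.LocAC f) (hf1 : p.VanishesToOrder 1 f) (hAf : p.MemL2 (p.opAdag k f)) :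
    p.MemDomAdag k f := by
  have hf2 := hf1.memL2 zero_le_one
  refine ⟨hf2, hf, hAf, fun ψ hψ => ?_⟩
  obtain ⟨c, d, hc, hd, hdc⟩ := exists_boundary_limits hL hW hψ hf hf2 hAf
  obtain rfl : c = 0 := boundary_limit_eq_zero (l := 𝓝[>] 0) hψ.1 hf1
    (nhdsGT_le_nhdsNE 0) (Ioo_mem_nhdsGT hL) (by simp) hc
  obtain rfl : d = 0 := boundary_limit_eq_zero (l := 𝓝[<] p.L) hψ.1 hf1
    (nhdsLT_le_nhdsNE p.L) (Ioo_mem_nhdsLT hL) (by simp [hL.ne']) hd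
  exact ⟨⟨0, hc, hd⟩, sub_eq_zero.1 (by rw [← hdc, sub_zero])⟩

end AdjointDomain

end PoschlTeller

section JacobiHypergeometric

open Polynomial

theorem ascPochhammer_eval_neg_natCast_mul_factorial {n s : ℕ} (h : s ≤ n) :
    (ascPochhammer ℂ s).eval (-(n : ℂ)) * ((n - s).factorial : ℂ)
      = (-1) ^ s * (n.factorial : ℂ) := by
  induction s with
  | zero => simp
  | succ s ih =>
    obtain ⟨d, rfl⟩ := Nat.exists_eq_add_of_le h
    have ih' := ih (by lia)
    rw [show s + 1 + d - s = d + 1 by lia, Nat.factorial_succ] at ih'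
    rw [show s + 1 + d - (s + 1) = d by lia, ascPochhammer_succ_eval]
    push_cast at ih' ⊢
    linear_combination -ih'

theorem ascPochhammer_eval_add {S : Type*} [CommSemiring S] (n m : ℕ) (z : S) :
    (ascPochhammer S (n + m)).eval z
      = (ascPochhammer S n).eval z * (ascPochhammer S m).eval (z + n) := by
  rw [← ascPochhammer_mul]
  simp

theorem ascPochhammer_eval_conj (n : ℕ) (z : ℂ) :
    (ascPochhammer ℂ n).eval (starRingEnd ℂ z) = starRingEnd ℂ ((ascPochhammer ℂ n).eval z) := by
  induction n with
  | zero => simp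
  | succ n ih => simp [ascPochhammer_succ_eval, ih]

theorem jacobiShifted_coeff_eq_hypergeometric {n s : ℕ} (a b : ℂ) (hs : s ≤ n)
    (ha : (ascPochhammer ℂ s).eval (a + 1) ≠ 0) :
    (jacobiShifted n a b).coeff s = (ascPochhammer ℂ n).eval (a + 1) / (n.factorial : ℂ)
      * ((-1) ^ s * ((ascPochhammer ℂ s).eval (-(n : ℂ)) * (ascPochhammer ℂ s).eval (n + a + b + 1)
        / ((ascPochhammer ℂ s).eval (a + 1) * (s.factorial : ℂ)))) := by
  have hsplit : (ascPochhammer ℂ n).eval (a + 1)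
      = (ascPochhammer ℂ s).eval (a + 1) * (ascPochhammer ℂ (n - s)).eval (a + s + 1) := by
    rw [add_right_comm a, ← ascPochhammer_eval_add, Nat.add_sub_cancel' hs]
  have hneg := ascPochhammer_eval_neg_natCast_mul_factorial hs
  have hsign : ((-1 : ℂ) ^ s) * (-1) ^ s = 1 := by rw [← mul_pow]; norm_num
  have hn : (n.factorial : ℂ) ≠ 0 := Nat.cast_ne_zero.2 n.factorial_ne_zero
  have hs! : (s.factorial : ℂ) ≠ 0 := Nat.cast_ne_zero.2 s.factorial_ne_zero
  have hns : ((n - s).factorial : ℂ) ≠ 0 := Nat.cast_ne_zero.2 (n - s).factorial_ne_zero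
  rw [← eq_div_iff hns] at hneg
  rw [jacobiShifted_coeff, if_pos hs, hsplit, hneg]
  field_simp
  linear_combination (-(ascPochhammer ℂ s).eval (n + a + b + 1)
    * (ascPochhammer ℂ (n - s)).eval (a + s + 1)) * hsign

theorem I_mul_cot_sub_one_div_two {θ : ℝ} (h : Real.sin θ ≠ 0) :
    (Complex.I * (Real.cot θ : ℝ) - 1) / 2
      = -(Complex.exp (Complex.I * ((θ : ℂ) - Real.pi / 2)) / (2 * (Real.sin θ : ℂ))) := by
  have h' : (Real.sin θ : ℂ) ≠ 0 := Complex.ofReal_ne_zero.2 h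
  have hexp : Complex.exp (Complex.I * ((θ : ℂ) - Real.pi / 2))
      = (Complex.cos θ + Complex.sin θ * Complex.I) * -Complex.I := by
    rw [← Complex.exp_mul_I, ← Complex.exp_neg_pi_div_two_mul_I, ← Complex.exp_add]
    ring_nf
  rw [hexp, Real.cot_eq_cos_div_sin]
  push_cast at h' ⊢
  field_simp
  linear_combination -Complex.sin (θ : ℂ) * Complex.I_sq

end JacobiHypergeometric

section SinExpSquare

theorem conj_sinExp (s : ℝ) (y : ℂ) (θ : ℝ) :
    starRingEnd ℂ (sinExp s y θ) = sinExp s (-starRingEnd ℂ y) θ := by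
  simp only [sinExp, map_mul, Complex.conj_ofReal, ← Complex.exp_conj, Complex.conj_I, map_sub,
    map_div₀, map_ofNat]
  ring_nf

theorem sinExp_mul_sinExp {θ : ℝ} (hθ : 0 < Real.sin θ) (s s' : ℝ) (y y' : ℂ) :
    sinExp s y θ * sinExp s' y' θ = sinExp (s + s') (y + y') θ := by
  simp only [sinExp, Real.rpow_add hθ, mul_add, add_mul, Complex.exp_add, Complex.ofReal_mul]
  ring

theorem integral_norm_sq_sum_sinExp {ι : Type*} (t : Finset ι) (c : ι → ℂ) {s : ι → ℝ}
    (hs : ∀ i ∈ t, 0 ≤ s i) (y : ι → ℂ) :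
    ((∫ θ in (0 : ℝ)..Real.pi, ‖∑ i ∈ t, c i * sinExp (s i) (y i) θ‖ ^ 2 : ℝ) : ℂ)
      = ∑ i ∈ t, ∑ j ∈ t, starRingEnd ℂ (c i) * c j
          * sinExpIntegral (s i + s j) (y j - starRingEnd ℂ (y i)) := by
  have hexpand : EqOn (fun θ => ((‖∑ i ∈ t, c i * sinExp (s i) (y i) θ‖ ^ 2 : ℝ) : ℂ))
      (fun θ => ∑ i ∈ t, ∑ j ∈ t, starRingEnd ℂ (c i) * c j
        * sinExp (s i + s j) (y j - starRingEnd ℂ (y i)) θ) (Ioo 0 Real.pi) := by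
    intro θ hθ
    simp only [← Complex.normSq_eq_norm_sq, Complex.normSq_eq_conj_mul_self, map_sum, map_mul,
      conj_sinExp, Finset.sum_mul_sum]
    refine Finset.sum_congr rfl fun i _ => Finset.sum_congr rfl fun j _ => ?_
    rw [sub_eq_neg_add, ← sinExp_mul_sinExp (Real.sin_pos_of_mem_Ioo hθ)]
    ring
  have hint (i) (hi : i ∈ t) (j) (hj : j ∈ t) : IntervalIntegrable (fun θ =>
      starRingEnd ℂ (c i) * c j * sinExp (s i + s j) (y j - starRingEnd ℂ (y i)) θ)
      volume 0 Real.pi :=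
    (intervalIntegrable_sinExp (add_nonneg (hs i hi) (hs j hj)) _ _ _).const_mul _
  rw [← intervalIntegral.integral_ofReal,
    intervalIntegral.integral_congr_Ioo_of_le Real.pi_pos.le hexpand,
    intervalIntegral.integral_finsetSum fun i hi =>
      (IntervalIntegrable.sum t (hint i hi)).congr fun θ _ => by simp only [Finset.sum_apply]]
  refine Finset.sum_congr rfl fun i hi => ?_
  rw [intervalIntegral.integral_finsetSum (hint i hi)]
  exact Finset.sum_congr rfl fun j _ => intervalIntegral.integral_const_mul _ _

end SinExpSquare

namespace PoschlTeller

section Normalization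

open Polynomial

variable {p : PoschlTeller}

/-- The coefficient of the `s`-th power of `e^{i(θ - π/2)} / (2 sin θ)` in
`(n! / (a_n + 1)_n) P_n^{(a_n, conj a_n)}(i cot θ)`. -/
noncomputable def hyperCoeff (p : PoschlTeller) (n s : ℕ) : ℂ :=
  (ascPochhammer ℂ s).eval (-(n : ℂ)) * (ascPochhammer ℂ s).eval (-2 * (p.ν : ℂ) - n - 1)
    / ((ascPochhammer ℂ s).eval (p.aParam n + 1) * (s.factorial : ℂ))

theorem conj_hyperCoeff (n s : ℕ) : starRingEnd ℂ (p.hyperCoeff n s)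
    = (ascPochhammer ℂ s).eval (-(n : ℂ)) * (ascPochhammer ℂ s).eval (-2 * (p.ν : ℂ) - n - 1)
      / ((ascPochhammer ℂ s).eval (starRingEnd ℂ (p.aParam n) + 1) * (s.factorial : ℂ)) := by
  simp only [hyperCoeff, map_div₀, map_mul, ← ascPochhammer_eval_conj, map_sub, map_add, map_neg,
    map_one, map_natCast, map_ofNat, Complex.conj_ofReal]

theorem eigenPoly_eval_cot (hν : -1 < p.ν) (n : ℕ) {θ : ℝ} (hθ : Real.sin θ ≠ 0) :
    (p.eigenPoly n).eval ((Real.cot θ : ℝ) : ℂ)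
      = (ascPochhammer ℂ n).eval (p.aParam n + 1) / (n.factorial : ℂ)
        * ∑ s ∈ Finset.range (n + 1), p.hyperCoeff n s
          * (Complex.exp (Complex.I * ((θ : ℂ) - Real.pi / 2)) / (2 * (Real.sin θ : ℂ))) ^ s := by
  have hsum : (n : ℂ) + p.aParam n + starRingEnd ℂ (p.aParam n) + 1 = -2 * (p.ν : ℂ) - n - 1 := by
    rw [conj_aParam, aParam_eq, expo]
    push_cast
    ring
  rw [eigenPoly, jacobiImag_eval, ← jacobiShifted_eval, I_mul_cot_sub_one_div_two hθ,
    eval_eq_sum_range' (Nat.lt_succ_of_le (natDegree_jacobiShifted_le n _ _)), Finset.mul_sum]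
  refine Finset.sum_congr rfl fun s hs => ?_
  have hs : s ≤ n := Finset.mem_range_succ_iff.1 hs
  have hsign : ((-1 : ℂ) ^ s) * (-1) ^ s = 1 := by rw [← mul_pow]; norm_num
  rw [jacobiShifted_coeff_eq_hypergeometric _ _ hs (ascPochhammer_aParam_ne_zero hν hs), hsum,
    hyperCoeff, neg_pow (Complex.exp _ / _)]
  linear_combination ((ascPochhammer ℂ n).eval (p.aParam n + 1) / (n.factorial : ℂ)
    * ((ascPochhammer ℂ s).eval (-(n : ℂ)) * (ascPochhammer ℂ s).eval (-2 * (p.ν : ℂ) - n - 1)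
      / ((ascPochhammer ℂ s).eval (p.aParam n + 1) * (s.factorial : ℂ)))
    * (Complex.exp (Complex.I * ((θ : ℂ) - Real.pi / 2)) / (2 * (Real.sin θ : ℂ))) ^ s) * hsign

theorem rpow_sin_mul_exp_mul_pow {θ : ℝ} (hθ : 0 < Real.sin θ) (a c : ℝ) (s : ℕ) :
    ((Real.sin θ ^ a : ℝ) : ℂ) * (Real.exp (-(c * θ)) : ℝ)
        * (Complex.exp (Complex.I * ((θ : ℂ) - Real.pi / 2)) / (2 * (Real.sin θ : ℂ))) ^ s
      = (Real.exp (-(c * Real.pi / 2)) : ℝ) / 2 ^ s * sinExp (a - s) (s + Complex.I * c) θ := by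
  have hexp : ((Real.exp (-(c * θ)) : ℝ) : ℂ)
        * Complex.exp (Complex.I * ((θ : ℂ) - Real.pi / 2)) ^ s
      = (Real.exp (-(c * Real.pi / 2)) : ℝ)
        * Complex.exp (Complex.I * (s + Complex.I * c) * ((θ : ℂ) - Real.pi / 2)) := by
    rw [Complex.ofReal_exp, Complex.ofReal_exp, ← Complex.exp_nat_mul, ← Complex.exp_add,
      ← Complex.exp_add]
    congr 1
    push_cast
    linear_combination (-c * ((θ : ℂ) - Real.pi / 2)) * Complex.I_sq
  rw [sinExp, Real.rpow_sub_natCast hθ.ne', div_pow, mul_pow]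
  push_cast at hexp ⊢
  linear_combination ((Real.sin θ ^ a : ℝ) : ℂ) / (2 ^ s * Complex.sin θ ^ s) * hexp

theorem sinCotWave_eigenPoly (hν : -1 < p.ν) (n : ℕ) (c : ℝ) {θ : ℝ} (hθ : 0 < Real.sin θ) :
    sinCotWave (p.expo n) c (p.eigenPoly n) θ
      = (ascPochhammer ℂ n).eval (p.aParam n + 1) / (n.factorial : ℂ)
        * (Real.exp (-(c * Real.pi / 2)) : ℝ)
        * ∑ s ∈ Finset.range (n + 1),
          p.hyperCoeff n s / 2 ^ s * sinExp (p.expo n - s) (s + Complex.I * c) θ := by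
  rw [sinCotWave, eigenPoly_eval_cot hν n hθ.ne', mul_left_comm, mul_assoc (_ / _)]
  congr 1
  rw [Finset.mul_sum, Finset.mul_sum]
  refine Finset.sum_congr rfl fun s _ => ?_
  linear_combination p.hyperCoeff n s * rpow_sin_mul_exp_mul_pow hθ (p.expo n) c s

theorem calT_eq (n : ℕ) :
    p.calT n = ‖(ascPochhammer ℂ n).eval (p.aParam n + 1) / (n.factorial : ℂ)‖⁻¹ := by
  have ha : -(n : ℂ) - p.ν + Complex.I * p.β / ((n : ℂ) + p.ν + 1) = p.aParam n + 1 := by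
    rw [aParam]
    ring
  rw [calT, ha, norm_div, Complex.norm_natCast, inv_div, div_eq_mul_inv]

theorem calT_pos (hν : -1 < p.ν) (n : ℕ) : 0 < p.calT n := by
  rw [calT_eq]
  exact inv_pos.2 (norm_pos_iff.2 (div_ne_zero (ascPochhammer_aParam_ne_zero hν le_rfl)
    (Nat.cast_ne_zero.2 n.factorial_ne_zero)))

theorem calO_eq_sum (n : ℕ) :
    p.calO n = ∑ k ∈ Finset.range (n + 1), ∑ s ∈ Finset.range (n + 1),
      starRingEnd ℂ (p.hyperCoeff n k) * p.hyperCoeff n s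
        * (Complex.Gamma (2 * p.expo n - k - s + 1)
          / (Complex.Gamma (p.expo n - k + 1 + Complex.I * (p.β / p.expo n : ℝ))
            * Complex.Gamma (p.expo n - s + 1 - Complex.I * (p.β / p.expo n : ℝ)))) := by
  unfold calO
  refine Finset.sum_congr rfl fun k _ => ?_
  rw [Finset.mul_sum]
  refine Finset.sum_congr rfl fun s _ => ?_
  have hc : Complex.I * p.β / ((n : ℂ) + p.ν + 1) = Complex.I * (p.β / p.expo n : ℝ) := by
    rw [expo]
    push_cast
    ring
  have ha : -(p.ν : ℂ) - n + Complex.I * (p.β / p.expo n : ℝ) = p.aParam n + 1 := by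
    rw [aParam_eq, expo]
    push_cast
    ring
  have ha' : -(p.ν : ℂ) - n - Complex.I * (p.β / p.expo n : ℝ)
      = starRingEnd ℂ (p.aParam n) + 1 := by
    rw [conj_aParam, expo]
    push_cast
    ring
  have hk : (n : ℂ) + p.ν + 2 - k = p.expo n - k + 1 := by rw [expo]; push_cast; ring
  have hs : (n : ℂ) + p.ν + 2 - s = p.expo n - s + 1 := by rw [expo]; push_cast; ring
  have hks : 2 * (n : ℂ) + 2 * p.ν - s - k + 3 = 2 * p.expo n - k - s + 1 := by
    rw [expo]
    push_cast
    ring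
  rw [hc, ha, ha', hk, hs, hks, conj_hyperCoeff, hyperCoeff]
  simp only [div_eq_mul_inv, mul_inv]
  ring

theorem integral_norm_sq_sum_hyperCoeff (hν : -1 < p.ν) (n : ℕ) :
    ((∫ θ in (0 : ℝ)..Real.pi, ‖∑ s ∈ Finset.range (n + 1), p.hyperCoeff n s / 2 ^ s
        * sinExp (p.expo n - s) (s + Complex.I * (p.β / p.expo n : ℝ)) θ‖ ^ 2 : ℝ) : ℂ)
      = Real.pi * ((2 ^ (-(2 * p.expo n)) : ℝ) : ℂ) * p.calO n := by
  have hexpo {s : ℕ} (hs : s ∈ Finset.range (n + 1)) : 0 ≤ p.expo n - s := by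
    have : (s : ℝ) ≤ n := by exact_mod_cast Finset.mem_range_succ_iff.1 hs
    unfold expo
    linarith
  rw [integral_norm_sq_sum_sinExp _ _ fun s hs => hexpo hs, calO_eq_sum, Finset.mul_sum]
  refine Finset.sum_congr rfl fun k hk => ?_
  rw [Finset.mul_sum]
  refine Finset.sum_congr rfl fun s hs => ?_
  set c : ℝ := p.β / p.expo n
  have hfreq : (s : ℂ) + Complex.I * c - starRingEnd ℂ ((k : ℂ) + Complex.I * c)
      = 2 * (((s : ℂ) - k) / 2 + Complex.I * c) := by
    simp only [map_add, map_mul, map_natCast, Complex.conj_ofReal, Complex.conj_I]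
    ring
  have hpow : (2 : ℝ) ^ (-(p.expo n - k + (p.expo n - s)))
      = (2 : ℝ) ^ (-(2 * p.expo n)) * 2 ^ k * 2 ^ s := by
    rw [← Real.rpow_natCast, ← Real.rpow_natCast, ← Real.rpow_add two_pos, ← Real.rpow_add two_pos]
    ring_nf
  rw [hfreq, sinExpIntegral_eq (add_nonneg (hexpo hk) (hexpo hs)), hpow, map_div₀, map_pow,
    map_ofNat]
  have hks : ((p.expo n - k + (p.expo n - s) : ℝ) : ℂ) = 2 * p.expo n - k - s := by
    push_cast
    ring
  have hk' : (2 * p.expo n - k - s : ℂ) / 2 + 1 + (((s : ℂ) - k) / 2 + Complex.I * c)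
      = p.expo n - k + 1 + Complex.I * c := by ring
  have hs' : (2 * p.expo n - k - s : ℂ) / 2 + 1 - (((s : ℂ) - k) / 2 + Complex.I * c)
      = p.expo n - s + 1 - Complex.I * c := by ring
  rw [hks, hk', hs']
  push_cast
  field_simp

end Normalization

end PoschlTeller

section SinCotWaveNorm

open Polynomial

theorem exists_mem_Ioo_cot_eq (t : ℝ) : ∃ θ ∈ Ioo 0 Real.pi, Real.cot θ = t := by
  refine ⟨Real.pi / 2 - Real.arctan t, ⟨?_, ?_⟩, ?_⟩
  · linarith [Real.arctan_lt_pi_div_two t]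
  · linarith [Real.neg_pi_div_two_lt_arctan t]
  · rw [Real.cot_eq_cos_div_sin, Real.cos_pi_div_two_sub, Real.sin_pi_div_two_sub,
      ← Real.tan_eq_sin_div_cos, Real.tan_arctan]

theorem exists_eval_ofReal_ne_zero {R : ℂ[X]} (hR : R ≠ 0) : ∃ t : ℝ, R.eval (t : ℂ) ≠ 0 := by
  by_contra! h
  refine hR (eq_zero_of_infinite_isRoot R ?_)
  refine (infinite_range_of_injective Complex.ofReal_injective).mono ?_
  rintro _ ⟨t, rfl⟩
  exact h t

theorem sinCotWave_ne_zero {a b : ℝ} {R : ℂ[X]} {θ : ℝ} (hθ : 0 < Real.sin θ)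
    (hR : R.eval ((Real.cot θ : ℝ) : ℂ) ≠ 0) : sinCotWave a b R θ ≠ 0 :=
  mul_ne_zero (mul_ne_zero (Complex.ofReal_ne_zero.2 (Real.rpow_pos_of_pos hθ a).ne')
    (Complex.ofReal_ne_zero.2 (Real.exp_pos _).ne')) hR

theorem integral_norm_sq_sinCotWave_pos {a : ℝ} (b : ℝ) {R : ℂ[X]} (hR : (R.natDegree : ℝ) ≤ a)
    (hR0 : R ≠ 0) : 0 < ∫ θ in (0 : ℝ)..Real.pi, ‖sinCotWave a b R θ‖ ^ 2 := by
  obtain ⟨g, hg, h⟩ := exists_continuous_sinCotWave_eq b le_rfl ((zero_add _).trans_le hR)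
  simp only [Real.rpow_zero, Complex.ofReal_one, one_mul] at h
  obtain ⟨t, ht⟩ := exists_eval_ofReal_ne_zero hR0
  obtain ⟨θ, hθ, rfl⟩ := exists_mem_Ioo_cot_eq t
  have hsin := Real.sin_pos_of_mem_Ioo hθ
  have hcongr : ∫ θ in (0 : ℝ)..Real.pi, ‖sinCotWave a b R θ‖ ^ 2
      = ∫ θ in (0 : ℝ)..Real.pi, ‖g θ‖ ^ 2 :=
    intervalIntegral.integral_congr_Ioo_of_le Real.pi_pos.le fun x hx => by
      simp only [h x (Real.sin_pos_of_mem_Ioo hx)]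
  rw [hcongr]
  refine intervalIntegral.integral_pos Real.pi_pos (by fun_prop) (fun x _ => by positivity)
    ⟨θ, Ioo_subset_Icc_self hθ, ?_⟩
  have : g θ ≠ 0 := h θ hsin ▸ sinCotWave_ne_zero hsin ht
  positivity

end SinCotWaveNorm

namespace PoschlTeller

section NormalizationConstant

open Polynomial

variable {p : PoschlTeller}

theorem integral_norm_sq_polyWave (hL : 0 < p.L) (n : ℕ) (R : ℂ[X]) :
    ∫ x in (0 : ℝ)..p.L, ‖p.polyWave n R x‖ ^ 2
      = p.L / Real.pi
        * ∫ θ in (0 : ℝ)..Real.pi, ‖sinCotWave (p.expo n) (p.β / p.expo n) R θ‖ ^ 2 := by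
  have h := intervalIntegral.integral_comp_mul_left (a := 0) (b := p.L)
    (fun θ => ‖sinCotWave (p.expo n) (p.β / p.expo n) R θ‖ ^ 2) (div_pos Real.pi_pos hL).ne'
  rw [mul_zero, div_mul_cancel₀ _ hL.ne', inv_div, smul_eq_mul] at h
  simpa only [polyWave, mul_div_right_comm] using h

theorem calT_sq_mul_norm_sq_sinCotWave (hν : -1 < p.ν) (n : ℕ) (c : ℝ) {θ : ℝ}
    (hθ : 0 < Real.sin θ) :
    p.calT n ^ 2 * ‖sinCotWave (p.expo n) c (p.eigenPoly n) θ‖ ^ 2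
      = Real.exp (-(c * Real.pi)) * ‖∑ s ∈ Finset.range (n + 1), p.hyperCoeff n s / 2 ^ s
        * sinExp (p.expo n - s) (s + Complex.I * c) θ‖ ^ 2 := by
  have hexp : Real.exp (-(c * Real.pi)) = Real.exp (-(c * Real.pi / 2)) ^ 2 := by
    rw [← Real.exp_nat_mul]
    congr 1
    push_cast
    ring
  have hT := calT_pos hν n
  rw [calT_eq] at hT ⊢
  rw [sinCotWave_eigenPoly hν n c hθ, norm_mul, norm_mul, Complex.norm_real, Real.norm_eq_abs,
    Real.abs_exp, hexp, mul_pow, mul_pow, inv_pow, mul_assoc,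
    inv_mul_cancel_left₀ (pow_ne_zero 2 (inv_pos.1 hT).ne')]

theorem calT_sq_mul_integral_norm_sq (hL : 0 < p.L) (hν : -1 < p.ν) (n : ℕ) :
    ((p.calT n ^ 2 * ∫ x in (0 : ℝ)..p.L, ‖p.polyWave n (p.eigenPoly n) x‖ ^ 2 : ℝ) : ℂ)
      = ((p.L * Real.exp (-(p.β / p.expo n * Real.pi)) * 2 ^ (-(2 * p.expo n)) : ℝ) : ℂ)
        * p.calO n := by
  have hcongr := intervalIntegral.integral_congr_Ioo_of_le (μ := volume) Real.pi_pos.le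
    fun θ hθ => calT_sq_mul_norm_sq_sinCotWave hν n (p.β / p.expo n) (Real.sin_pos_of_mem_Ioo hθ)
  rw [intervalIntegral.integral_const_mul, intervalIntegral.integral_const_mul] at hcongr
  rw [integral_norm_sq_polyWave hL, mul_left_comm, hcongr, Complex.ofReal_mul, Complex.ofReal_mul,
    integral_norm_sq_sum_hyperCoeff hν]
  push_cast
  have := Complex.ofReal_ne_zero.2 Real.pi_ne_zero
  field_simp

theorem integral_norm_sq_polyWave_eigenPoly_pos (hL : 0 < p.L) (hν : -1 < p.ν) (n : ℕ) :
    0 < ∫ x in (0 : ℝ)..p.L, ‖p.polyWave n (p.eigenPoly n) x‖ ^ 2 := by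
  have hdeg : ((p.eigenPoly n).natDegree : ℝ) ≤ p.expo n := by
    have : ((p.eigenPoly n).natDegree : ℝ) ≤ n := by
      exact_mod_cast natDegree_jacobiImag_le n _ _
    unfold expo
    linarith
  rw [integral_norm_sq_polyWave hL]
  exact mul_pos (div_pos hL Real.pi_pos)
    (integral_norm_sq_sinCotWave_pos _ hdeg (hierPoly_ne_zero hν n.zero_le))

theorem exists_calO_eq_ofReal_pos (hL : 0 < p.L) (hν : -1 < p.ν) (n : ℕ) :
    ∃ o : ℝ, 0 < o ∧ p.calO n = o ∧
      p.calT n ^ 2 * ∫ x in (0 : ℝ)..p.L, ‖p.polyWave n (p.eigenPoly n) x‖ ^ 2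
        = p.L * Real.exp (-(p.β / p.expo n * Real.pi)) * 2 ^ (-(2 * p.expo n)) * o := by
  have h := calT_sq_mul_integral_norm_sq hL hν n
  set I := p.calT n ^ 2 * ∫ x in (0 : ℝ)..p.L, ‖p.polyWave n (p.eigenPoly n) x‖ ^ 2
  have hI0 : 0 < I :=
    mul_pos (pow_pos (calT_pos hν n) 2) (integral_norm_sq_polyWave_eigenPoly_pos hL hν n)
  set D := p.L * Real.exp (-(p.β / p.expo n * Real.pi)) * 2 ^ (-(2 * p.expo n))
  have hD : 0 < D := by positivity
  refine ⟨I / D, div_pos hI0 hD, ?_, (mul_div_cancel₀ I hD.ne').symm⟩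
  rw [Complex.ofReal_div, eq_div_iff (Complex.ofReal_ne_zero.2 hD.ne'), h, mul_comm]

theorem norm_sq_normK {o : ℝ} (ho : 0 < o) (hL : 0 < p.L) {n : ℕ} (hO : p.calO n = o) :
    ‖p.normK n‖ ^ 2
      = 2 ^ (2 * p.expo n) * p.L⁻¹ * p.calT n ^ 2 * o⁻¹
        * Real.exp (p.β / p.expo n * Real.pi) := by
  have hK : p.normK n = ((2 ^ p.expo n * p.L ^ (-(1 / 2) : ℝ) * p.calT n * o ^ (-(1 / 2) : ℝ)
      * Real.exp (p.β * Real.pi / (2 * p.expo n)) : ℝ) : ℂ) := by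
    have hcpow : p.calO n ^ (-(1 / 2) : ℂ) = ((o ^ (-(1 / 2) : ℝ) : ℝ) : ℂ) := by
      rw [hO, Complex.ofReal_cpow ho.le]
      push_cast
      rfl
    rw [normK, hcpow, expo]
    push_cast
    rfl
  have hsq {y : ℝ} (hy : 0 < y) : (y ^ (-(1 / 2) : ℝ)) ^ 2 = y⁻¹ := by
    rw [← Real.rpow_mul_natCast hy.le, ← Real.rpow_neg_one]
    norm_num
  have htwo : ((2 : ℝ) ^ p.expo n) ^ 2 = 2 ^ (2 * p.expo n) := by
    rw [← Real.rpow_mul_natCast two_pos.le, Nat.cast_ofNat, mul_comm]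
  have hexp : Real.exp (p.β * Real.pi / (2 * p.expo n)) ^ 2
      = Real.exp (p.β / p.expo n * Real.pi) := by
    rw [← Real.exp_nat_mul]
    congr 1
    push_cast
    field_simp
  rw [hK, Complex.norm_real, Real.norm_eq_abs, sq_abs]
  simp only [mul_pow, hsq hL, hsq ho, htwo, hexp]

theorem norm_sq_normK_mul_integral (hL : 0 < p.L) (hν : -1 < p.ν) (n : ℕ) :
    ‖p.normK n‖ ^ 2 * ∫ x in (0 : ℝ)..p.L, ‖p.polyWave n (p.eigenPoly n) x‖ ^ 2 = 1 := by
  obtain ⟨o, ho, hO, h⟩ := exists_calO_eq_ofReal_pos hL hν n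
  have htwo : (0 : ℝ) < 2 ^ (2 * p.expo n) := by positivity
  rw [norm_sq_normK ho hL hO]
  rw [Real.exp_neg, Real.rpow_neg two_pos.le] at h
  have hexp := Real.exp_pos (p.β / p.expo n * Real.pi)
  generalize Real.exp (p.β / p.expo n * Real.pi) = E at *
  field_simp at h ⊢
  linear_combination h

end NormalizationConstant

section Wave

open Polynomial

variable {p : PoschlTeller} {n k : ℕ} {R : ℂ[X]} {c d : ℂ} {f : ℝ → ℂ} {x : ℝ}

/-- On `(0, L)`, the function `f` is `c` times the wave of the polynomial `R`. -/
def IsWave (p : PoschlTeller) (n : ℕ) (R : ℂ[X]) (c : ℂ) (f : ℝ → ℂ) : Prop :=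
  EqOn f (fun x => c * p.polyWave n R x) (Ioo 0 p.L)

/-- The momentum scale `ħπ/L`. -/
noncomputable def momentum (p : PoschlTeller) : ℝ := p.ħ * Real.pi / p.L

/-- The superpotential of level `k` as an explicit function: `-ħ` times the logarithmic derivative
of `sin^{k+ν+1}(πx/L) exp(-βπx/(L(k+ν+1)))`. -/
noncomputable def cotSuperpot (p : PoschlTeller) (k : ℕ) (x : ℝ) : ℂ :=
  -p.momentum * (p.groundPoly k).eval ((Real.cot (Real.pi * x / p.L) : ℝ) : ℂ)

theorem conj_cotSuperpot (k : ℕ) (x : ℝ) :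
    starRingEnd ℂ (p.cotSuperpot k x) = p.cotSuperpot k x := by
  simp only [cotSuperpot, groundPoly, eval_sub, eval_mul, eval_C, eval_X, map_mul, map_neg,
    map_sub, Complex.conj_ofReal]

theorem momentum_eq : (p.momentum : ℂ) = p.ħ * (Real.pi / p.L : ℝ) := by
  rw [momentum, mul_div_assoc, Complex.ofReal_mul]

theorem momentum_pos (hħ : 0 < p.ħ) (hL : 0 < p.L) : 0 < p.momentum :=
  div_pos (mul_pos hħ Real.pi_pos) hL

theorem polyWave_mul (n : ℕ) (R S : ℂ[X]) (x : ℝ) :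
    p.polyWave n (R * S) x
      = R.eval ((Real.cot (Real.pi * x / p.L) : ℝ) : ℂ) * p.polyWave n S x := by
  simp only [polyWave, sinCotWave, eval_mul]
  ring

theorem polyWave_cotDeriv_add (n : ℕ) (g h R : ℂ[X]) (x : ℝ) :
    p.polyWave n (cotDeriv (g + h) R) x = p.polyWave n (cotDeriv g R) x
      + h.eval ((Real.cot (Real.pi * x / p.L) : ℝ) : ℂ) * p.polyWave n R x := by
  simp only [polyWave, sinCotWave, cotDeriv, eval_sub, eval_mul, eval_add]
  ring

theorem polyWave_cotDeriv_sub (n : ℕ) (g h R : ℂ[X]) (x : ℝ) :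
    p.polyWave n (cotDeriv (g - h) R) x = p.polyWave n (cotDeriv g R) x
      - h.eval ((Real.cot (Real.pi * x / p.L) : ℝ) : ℂ) * p.polyWave n R x := by
  simp only [polyWave, sinCotWave, cotDeriv, eval_sub, eval_mul]
  ring

theorem polyWave_C_ne_zero (n : ℕ) (hc : c ≠ 0) (hx : x ∈ Ioo 0 p.L) : p.polyWave n (C c) x ≠ 0 :=
  sinCotWave_ne_zero (sin_pos_of_mem_Ioo hx) (by rwa [eval_C])

theorem isWave_polyWave (n : ℕ) (R : ℂ[X]) : p.IsWave n R 1 (p.polyWave n R) :=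
  fun _ _ => (one_mul _).symm

namespace IsWave

theorem of_C_mul (hf : p.IsWave n (C d * R) c f) : p.IsWave n R (c * d) f := fun x hx => by
  simp only [hf hx, polyWave_C_mul, mul_assoc]

theorem div_const (hf : p.IsWave n R c f) (d : ℂ) : p.IsWave n R (c / d) fun x => f x / d :=
  fun x hx => by simp only [hf hx, mul_div_right_comm]

theorem deriv (hf : p.IsWave n R c f) :
    p.IsWave n (cotDeriv (p.groundPoly n) R) (c * (Real.pi / p.L : ℝ)) (deriv f) := fun x hx => by
  have hderiv := (hasDerivAt_polyWave n R hx).const_mul c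
  rw [(hderiv.congr_of_eventuallyEq (eventually_of_mem (isOpen_Ioo.mem_nhds hx) hf)).deriv]
  exact (mul_assoc _ _ _).symm

theorem contDiffOn (hf : p.IsWave n R c f) : ContDiffOn ℝ ∞ f (Ioo 0 p.L) :=
  (contDiffOn_const.mul (contDiffOn_polyWave n R)).congr hf

theorem locAC (hf : p.IsWave n R c f) : p.LocAC f :=
  locAC_of_contDiffOn (hf.contDiffOn.of_le (by norm_cast))

theorem vanishesToOrder {s : ℝ} (hf : p.IsWave n R c f) (hR : R.natDegree ≤ k)
    (hs : s + k ≤ p.expo n) : p.VanishesToOrder s f :=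
  ((vanishesToOrder_polyWave hR hs).const_mul c).congr hf

theorem opA (hf : p.IsWave n R c f) (hW : EqOn (p.superpot k) (p.cotSuperpot k) (Ioo 0 p.L)) :
    p.IsWave n (cotDeriv (p.groundPoly n - p.groundPoly k) R) (c * p.momentum) (p.opA k f) := by
  intro x hx
  simp only [PoschlTeller.opA, hf.deriv hx, hW hx, hf hx, cotSuperpot, momentum_eq,
    polyWave_cotDeriv_sub]
  ring

theorem opAdag (hf : p.IsWave n R c f) (hW : EqOn (p.superpot k) (p.cotSuperpot k) (Ioo 0 p.L)) :
    p.IsWave n (cotDeriv (p.groundPoly n + p.groundPoly k) R) (-(c * p.momentum))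
      (p.opAdag k f) := by
  intro x hx
  simp only [PoschlTeller.opAdag, hf.deriv hx, hW hx, hf hx, cotSuperpot, momentum_eq,
    polyWave_cotDeriv_add]
  ring

theorem superpotOf_eqOn (hf : p.IsWave k (C d) c f) (hc : c ≠ 0) (hd : d ≠ 0) :
    EqOn (p.superpotOf f) (p.cotSuperpot k) (Ioo 0 p.L) := by
  intro x hx
  have hground : cotDeriv (p.groundPoly k) (C d) = p.groundPoly k * C d := by
    rw [cotDeriv, derivative_C, mul_zero, sub_zero]
  have := polyWave_C_ne_zero k hd hx
  simp only [superpotOf, hf.deriv hx, hf hx, cotSuperpot, momentum_eq, hground, polyWave_mul]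
  field_simp

theorem innerL2_eq {u v : ℝ → ℂ} (hL : 0 < p.L) (hu : p.IsWave n R c u) (hv : p.IsWave n R d v) :
    p.innerL2 u v
      = starRingEnd ℂ c * d * (∫ x in (0 : ℝ)..p.L, ‖p.polyWave n R x‖ ^ 2 : ℝ) := by
  rw [innerL2, intervalIntegral.integral_of_le hL.le, integral_Ioc_eq_integral_Ioo,
    ← integral_complex_ofReal, ← integral_const_mul]
  refine setIntegral_congr_fun measurableSet_Ioo fun x hx => ?_
  simp only [hu hx, hv hx, map_mul, Complex.ofReal_pow, ← Complex.conj_mul']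
  ring

end IsWave

end Wave

section Constants

variable {p : PoschlTeller}

theorem normK_ne_zero (hL : 0 < p.L) (hν : -1 < p.ν) (n : ℕ) : p.normK n ≠ 0 := by
  intro h
  simpa [h] using norm_sq_normK_mul_integral hL hν n

theorem two_mul_M_mul_eps0 (hM : 0 < p.M) (hL : 0 < p.L) :
    2 * p.M * p.eps0 = p.momentum ^ 2 := by
  unfold eps0 momentum
  field_simp

theorem energy_eq (n : ℕ) : p.energy n = p.eps0 * p.redEnergy n := by
  rw [energy, redEnergy, expo, div_pow]

theorem energyHier_eq (m n : ℕ) : p.energyHier m n = p.energy (n + m) := by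
  induction m generalizing n with
  | zero => rfl
  | succ m ih => rw [energyHier, ih, add_right_comm, add_assoc]

/-- The product `∏_{j<k} (E_n - E_j)` in units of `ε₀^k`. -/
noncomputable def gapProd (p : PoschlTeller) (n k : ℕ) : ℝ :=
  ∏ j ∈ Finset.range k, (p.redEnergy n - p.redEnergy j)

theorem gapProd_succ (n k : ℕ) :
    p.gapProd n (k + 1) = p.gapProd n k * (p.redEnergy n - p.redEnergy k) :=
  Finset.prod_range_succ _ k

theorem gapProd_pos (hν : -1 < p.ν) {n k : ℕ} (hk : k ≤ n) : 0 < p.gapProd n k :=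
  Finset.prod_pos fun _ hj =>
    sub_pos.2 (redEnergy_strictMono hν ((Finset.mem_range.1 hj).trans_le hk))

theorem sqrt_gapProd_ne_zero (hν : -1 < p.ν) {n k : ℕ} (hk : k ≤ n) :
    ((√(p.gapProd n k) : ℝ) : ℂ) ≠ 0 :=
  Complex.ofReal_ne_zero.2 (Real.sqrt_pos.2 (gapProd_pos hν hk)).ne'

theorem normHier_eq (hħ : 0 < p.ħ) (hM : 0 < p.M) (hL : 0 < p.L) (k n : ℕ) :
    p.normHier k n = p.momentum ^ k * √(p.gapProd (n + k) k) := by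
  have hprod : (2 * p.M) ^ k * ∏ j ∈ Finset.range k, (p.energy (n + k) - p.energy j)
      = (p.momentum ^ k) ^ 2 * p.gapProd (n + k) k := by
    simp only [energy_eq, ← mul_sub, Finset.prod_mul_distrib, Finset.prod_const,
      Finset.card_range, gapProd]
    rw [← mul_assoc, ← mul_pow, two_mul_M_mul_eps0 hM hL, pow_right_comm]
  rw [normHier, hprod, Real.sqrt_mul (sq_nonneg _),
    Real.sqrt_sq (pow_pos (momentum_pos hħ hL) k).le]

theorem normHier_pos (hħ : 0 < p.ħ) (hM : 0 < p.M) (hL : 0 < p.L) (hν : -1 < p.ν) (k n : ℕ) :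
    0 < p.normHier k n := by
  rw [normHier_eq hħ hM hL]
  exact mul_pos (pow_pos (momentum_pos hħ hL) k)
    (Real.sqrt_pos.2 (gapProd_pos hν (Nat.le_add_left k n)))

theorem calM_eq (hν : -1 < p.ν) (n m : ℕ) :
    p.calM n m = √(p.gapProd (n + (m + 1)) (m + 1)) := by
  rw [calM, gapProd]
  congr 1
  refine Finset.prod_congr rfl fun k _ => ?_
  rw [redEnergy_sub hν]
  unfold expo
  push_cast
  ring

theorem phi_eq (hL : 0 < p.L) (hν : -1 < p.ν) (n : ℕ) (x : ℝ) :
    p.phi n x = ((2 : ℝ) ^ p.expo n : ℝ) * p.calT n * ((p.L : ℂ) * p.calO n) ^ (-(1 / 2) : ℂ)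
      * (Real.exp (p.β * Real.pi / p.expo n * (1 / 2 - x / p.L)) : ℝ)
      * ((Real.sin (Real.pi * x / p.L) ^ p.expo n : ℝ) : ℂ)
      * jacobiP n (p.aParam n) (starRingEnd ℂ (p.aParam n))
          (Complex.I * (Real.cot (Real.pi * x / p.L) : ℝ)) := by
  have hcpow : ((p.L : ℂ) * p.calO n) ^ (-(1 / 2) : ℂ)
      = ((p.L ^ (-(1 / 2) : ℝ) : ℝ) : ℂ) * p.calO n ^ (-(1 / 2) : ℂ) := by
    obtain ⟨o, ho, hO, -⟩ := exists_calO_eq_ofReal_pos hL hν n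
    rw [hO, Complex.mul_cpow_ofReal_nonneg hL.le ho.le, Complex.ofReal_cpow hL.le]
    push_cast
    rfl
  have hexp : Real.exp (p.β * Real.pi / p.expo n * (1 / 2 - x / p.L))
      = Real.exp (p.β * Real.pi / (2 * p.expo n))
        * Real.exp (-(p.β * Real.pi * x / (p.L * p.expo n))) := by
    have := (expo_pos hν n).ne'
    rw [← Real.exp_add]
    congr 1
    field_simp
    ring
  have hexpo : p.ν + n + 1 = p.expo n := by
    unfold expo
    ring
  rw [phi, normK, hexpo, ← expo, hcpow, hexp, Complex.ofReal_mul]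
  ring

end Constants

section Hierarchy

open Polynomial

variable {p : PoschlTeller} {n k : ℕ} {c : ℂ} {f : ℝ → ℂ} {x : ℝ}

theorem isWave_phi (n : ℕ) : p.IsWave n (p.eigenPoly n) (p.normK n) (p.phi n) := by
  intro x _
  have hexpo : p.ν + n + 1 = p.expo n := by
    unfold expo
    ring
  have hexp : p.β * Real.pi * x / (p.L * p.expo n) = p.β / p.expo n * (Real.pi * x / p.L) := by
    rw [div_mul_div_comm, mul_assoc, mul_comm p.L]
  simp only [phi, polyWave, sinCotWave, eigenPoly, jacobiImag_eval, hexpo, hexp]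
  ring

theorem isWave_ladder_of_superpot_eqOn
    (hW : ∀ j < k, EqOn (p.superpot j) (p.cotSuperpot j) (Ioo 0 p.L)) (n : ℕ) :
    p.IsWave n (p.hierPoly n k) (p.normK n * p.momentum ^ k) (p.ladder k (p.phi n)) := by
  induction k with
  | zero =>
    rw [pow_zero, mul_one]
    exact isWave_phi n
  | succ k ih =>
    rw [pow_succ, ← mul_assoc]
    exact (ih fun j hj => hW j (hj.trans k.lt_succ_self)).opA (hW k k.lt_succ_self)

theorem superpot_eqOn (hħ : 0 < p.ħ) (hM : 0 < p.M) (hL : 0 < p.L) (hν : -1 < p.ν) (k : ℕ) :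
    EqOn (p.superpot k) (p.cotSuperpot k) (Ioo 0 p.L) := by
  induction k using Nat.strong_induction_on with
  | _ k ih =>
    obtain ⟨d, hd, hpoly⟩ := exists_hierPoly_self_eq_C hν k
    have hladder := isWave_ladder_of_superpot_eqOn ih k
    rw [hpoly] at hladder
    have hground : p.IsWave k (C d) (p.normK k * p.momentum ^ k / p.normHier k 0)
        (p.phiHier k 0) := fun y hy => by
      rw [phiHier, Nat.zero_add]
      exact hladder.div_const (p.normHier k 0) hy
    have hmomentum : (p.momentum : ℂ) ≠ 0 := Complex.ofReal_ne_zero.2 (momentum_pos hħ hL).ne'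
    have hnorm : (p.normHier k 0 : ℂ) ≠ 0 :=
      Complex.ofReal_ne_zero.2 (normHier_pos hħ hM hL hν k 0).ne'
    exact hground.superpotOf_eqOn
      (div_ne_zero (mul_ne_zero (normK_ne_zero hL hν k) (pow_ne_zero k hmomentum)) hnorm) hd

theorem isWave_ladder (hħ : 0 < p.ħ) (hM : 0 < p.M) (hL : 0 < p.L) (hν : -1 < p.ν) (n k : ℕ) :
    p.IsWave n (p.hierPoly n k) (p.normK n * p.momentum ^ k) (p.ladder k (p.phi n)) :=
  isWave_ladder_of_superpot_eqOn (fun j _ => superpot_eqOn hħ hM hL hν j) n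

theorem isWave_phiHier (hħ : 0 < p.ħ) (hM : 0 < p.M) (hL : 0 < p.L) (hν : -1 < p.ν) (k n : ℕ) :
    p.IsWave (n + k) (p.hierPoly (n + k) k) (p.normK (n + k) / (√(p.gapProd (n + k) k) : ℝ))
      (p.phiHier k n) := by
  have hmomentum : (p.momentum : ℂ) ^ k ≠ 0 :=
    pow_ne_zero k (Complex.ofReal_ne_zero.2 (momentum_pos hħ hL).ne')
  have hwave := (isWave_ladder hħ hM hL hν (n + k) k).div_const (p.normHier k n)
  rwa [normHier_eq hħ hM hL, Complex.ofReal_mul, Complex.ofReal_pow, mul_comm (p.normK _),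
    mul_div_mul_left _ _ hmomentum, ← Complex.ofReal_pow, ← Complex.ofReal_mul,
    ← normHier_eq hħ hM hL] at hwave

theorem phiHier_zero_ne_zero (hħ : 0 < p.ħ) (hM : 0 < p.M) (hL : 0 < p.L) (hν : -1 < p.ν)
    (k : ℕ) (hx : x ∈ Ioo 0 p.L) : p.phiHier k 0 x ≠ 0 := by
  obtain ⟨d, hd, hpoly⟩ := exists_hierPoly_self_eq_C hν k
  have hwave := isWave_phiHier hħ hM hL hν k 0 hx
  rw [Nat.zero_add, hpoly] at hwave
  rw [hwave]
  exact mul_ne_zero (div_ne_zero (normK_ne_zero hL hν k) (sqrt_gapProd_ne_zero hν le_rfl))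
    (polyWave_C_ne_zero k hd hx)

namespace IsWave

theorem raise_hierPoly (hħ : 0 < p.ħ) (hM : 0 < p.M) (hL : 0 < p.L) (hν : -1 < p.ν)
    (hf : p.IsWave n (p.hierPoly n k) c f) :
    p.IsWave n (p.hierPoly n (k + 1)) (c * p.momentum) (p.opA k f) :=
  hf.opA (superpot_eqOn hħ hM hL hν k)

theorem lower_hierPoly (hħ : 0 < p.ħ) (hM : 0 < p.M) (hL : 0 < p.L) (hν : -1 < p.ν)
    (hf : p.IsWave n (p.hierPoly n (k + 1)) c f) :
    p.IsWave n (p.hierPoly n k) (c * p.momentum * ((p.redEnergy n - p.redEnergy k : ℝ) : ℂ))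
      (p.opAdag k f) := by
  have hwave := hf.opAdag (superpot_eqOn hħ hM hL hν k)
  rw [cotDeriv_hierPoly_succ hν] at hwave
  rw [← neg_mul_neg, ← Complex.ofReal_neg, neg_sub]
  exact hwave.of_C_mul

theorem vanishesToOrder_hierPoly {s : ℝ} (hν : -1 < p.ν) (hk : k ≤ n) (hs : s ≤ p.expo k)
    (hf : p.IsWave n (p.hierPoly n k) c f) : p.VanishesToOrder s f := by
  refine hf.vanishesToOrder (natDegree_hierPoly_le hν hk) ?_
  have hexpo : p.expo k + (n - k : ℕ) = p.expo n := by
    rw [expo, expo, Nat.cast_sub hk]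
    ring
  linarith

theorem memL2_hierPoly (hν : -1 < p.ν) (hk : k ≤ n) (hf : p.IsWave n (p.hierPoly n k) c f) :
    p.MemL2 f :=
  (hf.vanishesToOrder_hierPoly hν hk (expo_pos hν k).le).memL2 le_rfl

theorem memDomA (hħ : 0 < p.ħ) (hM : 0 < p.M) (hL : 0 < p.L) (hν : -1 < p.ν) (hk : k < n)
    (hf : p.IsWave n (p.hierPoly n k) c f) : p.MemDomA k f :=
  ⟨hf.memL2_hierPoly hν hk.le, hf.locAC, (hf.raise_hierPoly hħ hM hL hν).memL2_hierPoly hν hk⟩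

theorem memDomAdag (hħ : 0 < p.ħ) (hM : 0 < p.M) (hL : 0 < p.L) (hν : -1 < p.ν) (hk : k < n)
    (hf : p.IsWave n (p.hierPoly n (k + 1)) c f) : p.MemDomAdag k f := by
  have hone : 1 ≤ p.expo (k + 1) := by
    rw [expo_succ, le_add_iff_nonneg_left]
    exact (expo_pos hν k).le
  refine memDomAdag_of_vanishesToOrder_one hL (fun x hx => ?_) hf.locAC
    (hf.vanishesToOrder_hierPoly hν hk hone)
    ((hf.lower_hierPoly hħ hM hL hν).memL2_hierPoly hν hk.le)
  rw [superpot_eqOn hħ hM hL hν k hx, conj_cotSuperpot]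

theorem ladderDag (hħ : 0 < p.ħ) (hM : 0 < p.M) (hL : 0 < p.L) (hν : -1 < p.ν)
    (hf : p.IsWave n (p.hierPoly n k) c f) :
    p.IsWave n (p.eigenPoly n) (c * p.momentum ^ k * p.gapProd n k) (p.ladderDag k f) := by
  induction k generalizing c f with
  | zero =>
    rw [pow_zero, gapProd, Finset.prod_range_zero, Complex.ofReal_one, mul_one, mul_one]
    exact hf
  | succ k ih =>
    have hcoeff : c * p.momentum ^ (k + 1) * p.gapProd n (k + 1)
        = c * p.momentum * ((p.redEnergy n - p.redEnergy k : ℝ) : ℂ) * p.momentum ^ k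
          * p.gapProd n k := by
      rw [gapProd_succ, Complex.ofReal_mul]
      ring
    rw [hcoeff]
    exact ih (hf.lower_hierPoly hħ hM hL hν)

theorem memDomLadderDag (hħ : 0 < p.ħ) (hM : 0 < p.M) (hL : 0 < p.L) (hν : -1 < p.ν)
    (hk : k ≤ n) (hf : p.IsWave n (p.hierPoly n k) c f) : p.MemDomLadderDag k f := by
  induction k generalizing c f with
  | zero => exact hf.memL2_hierPoly hν hk
  | succ k ih =>
    exact ⟨hf.memDomAdag hħ hM hL hν hk,
      ih (Nat.le_of_succ_le hk) (hf.lower_hierPoly hħ hM hL hν)⟩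

end IsWave

theorem memDomLadder_phi (hħ : 0 < p.ħ) (hM : 0 < p.M) (hL : 0 < p.L) (hν : -1 < p.ν)
    (hk : k ≤ n) : p.MemDomLadder k (p.phi n) := by
  induction k with
  | zero => exact (isWave_ladder hħ hM hL hν n 0).memL2_hierPoly hν hk
  | succ k ih =>
    exact ⟨ih (Nat.le_of_succ_le hk), (isWave_ladder hħ hM hL hν n k).memDomA hħ hM hL hν hk⟩

-- `‖A_k ψ‖² = ⟨ψ, A_k† A_k ψ⟩`, and `A_k† A_k` multiplies `ψ` by a constant.
theorem integral_norm_sq_polyWave_hierPoly_succ (hħ : 0 < p.ħ) (hM : 0 < p.M) (hL : 0 < p.L)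
    (hν : -1 < p.ν) (hk : k < n) :
    ∫ x in (0 : ℝ)..p.L, ‖p.polyWave n (p.hierPoly n (k + 1)) x‖ ^ 2
      = (p.redEnergy n - p.redEnergy k)
        * ∫ x in (0 : ℝ)..p.L, ‖p.polyWave n (p.hierPoly n k) x‖ ^ 2 := by
  have hψ := p.isWave_polyWave n (p.hierPoly n k)
  have hf := p.isWave_polyWave n (p.hierPoly n (k + 1))
  have hadjoint := ((hf.memDomAdag hħ hM hL hν hk).2.2.2 _ (hψ.memDomA hħ hM hL hν hk)).2
  rw [(hψ.raise_hierPoly hħ hM hL hν).innerL2_eq hL hf,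
    hψ.innerL2_eq hL (hf.lower_hierPoly hħ hM hL hν)] at hadjoint
  simp only [one_mul, mul_one, map_one, Complex.conj_ofReal, ← Complex.ofReal_mul,
    Complex.ofReal_inj, mul_assoc] at hadjoint
  exact mul_left_cancel₀ (momentum_pos hħ hL).ne' hadjoint

theorem integral_norm_sq_polyWave_hierPoly (hħ : 0 < p.ħ) (hM : 0 < p.M) (hL : 0 < p.L)
    (hν : -1 < p.ν) (hk : k ≤ n) :
    ∫ x in (0 : ℝ)..p.L, ‖p.polyWave n (p.hierPoly n k) x‖ ^ 2
      = p.gapProd n k * ∫ x in (0 : ℝ)..p.L, ‖p.polyWave n (p.eigenPoly n) x‖ ^ 2 := by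
  induction k with
  | zero => rw [gapProd, Finset.prod_range_zero, one_mul, hierPoly]
  | succ k ih =>
    rw [integral_norm_sq_polyWave_hierPoly_succ hħ hM hL hν hk, ih (Nat.le_of_succ_le hk),
      gapProd_succ]
    ring

theorem isUnitVector_phiHier (hħ : 0 < p.ħ) (hM : 0 < p.M) (hL : 0 < p.L) (hν : -1 < p.ν)
    (k n : ℕ) : p.IsUnitVector (p.phiHier k n) := by
  have hk : k ≤ n + k := Nat.le_add_left k n
  have hwave := isWave_phiHier hħ hM hL hν k n
  have hgap := gapProd_pos hν hk
  refine ⟨hwave.memL2_hierPoly hν hk, ?_⟩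
  rw [hwave.innerL2_eq hL hwave, Complex.conj_mul',
    integral_norm_sq_polyWave_hierPoly hħ hM hL hν hk, norm_div, Complex.norm_real,
    Real.norm_of_nonneg (Real.sqrt_nonneg _), ← Complex.ofReal_pow, ← Complex.ofReal_mul,
    div_pow, Real.sq_sqrt hgap.le, div_mul_eq_mul_div, mul_left_comm,
    norm_sq_normK_mul_integral hL hν, mul_one, div_self hgap.ne', Complex.ofReal_one]

theorem potential_eq (hx : x ∈ Ioo 0 p.L) :
    (p.potential x : ℂ)
      = p.eps0 * (p.potentialPoly 0).eval ((Real.cot (Real.pi * x / p.L) : ℝ) : ℂ) := by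
  have hsin := (sin_pos_of_mem_Ioo hx).ne'
  have hinv : p.ν * (p.ν + 1) / Real.sin (Real.pi * x / p.L) ^ 2
      = p.ν * (p.ν + 1) * (1 + Real.cot (Real.pi * x / p.L) ^ 2) := by
    rw [div_eq_iff (pow_ne_zero 2 hsin), mul_assoc, add_mul, one_mul, ← mul_pow, cot_mul_sin hsin,
      Real.sin_sq_add_cos_sq, mul_one]
  rw [potential, hinv]
  simp only [potentialPoly, expo, eval_sub, eval_mul, eval_add, eval_C, eval_X, eval_one, eval_pow]
  push_cast
  ring

theorem eps0_eq : p.ħ ^ 2 / (2 * p.M) * (Real.pi / p.L) ^ 2 = p.eps0 := by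
  rw [eps0, div_pow, div_mul_div_comm]

theorem hamiltonian_phi (hν : -1 < p.ν) (n : ℕ) (hx : x ∈ Ioo 0 p.L) :
    p.hamiltonian (p.phi n) x = (p.energy n : ℂ) * p.phi n x := by
  have hwave := isWave_phi (p := p) n
  have heps : (p.eps0 : ℂ)
      = ((p.ħ ^ 2 / (2 * p.M) : ℝ) : ℂ) * ((Real.pi / p.L : ℝ) : ℂ) ^ 2 := by
    rw [← eps0_eq, Complex.ofReal_mul, Complex.ofReal_pow]
  have hode := congrArg (fun R => p.polyWave n R x) (cotDeriv_cotDeriv_eigenPoly hν n)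
  simp only [polyWave_mul, eval_sub, eval_C] at hode
  simp only [hamiltonian, hwave.deriv.deriv hx, hwave hx, potential_eq hx, energy_eq, hode,
    Complex.ofReal_mul, heps]
  ring

theorem phiHier_zero (n : ℕ) : p.phiHier 0 n = p.phi n := by
  funext x
  simp [phiHier, ladder, normHier]

theorem isNormalizedEigenfunction_phi (hħ : 0 < p.ħ) (hM : 0 < p.M) (hL : 0 < p.L)
    (hν : -1 < p.ν) (n : ℕ) : p.IsNormalizedEigenfunction (p.energy n) (p.phi n) := by
  have hwave := isWave_phi (p := p) n
  have hvanish : p.VanishesToOrder (p.expo 0) (p.phi n) :=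
    hwave.vanishesToOrder_hierPoly (k := 0) hν n.zero_le le_rfl
  have hpos := expo_pos hν 0
  have hH : EqOn (p.hamiltonian (p.phi n)) (fun x => (p.energy n : ℂ) * p.phi n x) (Ioo 0 p.L) :=
    fun x hx => hamiltonian_phi hν n hx
  have hunit : p.IsUnitVector (p.phi n) := by
    rw [← phiHier_zero]
    exact isUnitVector_phiHier hħ hM hL hν 0 n
  exact ⟨⟨hunit.1, hwave.locAC, hwave.deriv.locAC, hvanish.tendsto_left hL hpos,
    hvanish.tendsto_right hL hpos, ((hvanish.const_mul (p.energy n)).congr hH).memL2 hpos.le⟩,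
    hunit, hH⟩

theorem hamiltonianHier_phiHier (hħ : 0 < p.ħ) (hM : 0 < p.M) (hL : 0 < p.L) (hν : -1 < p.ν)
    (m n : ℕ) (hx : x ∈ Ioo 0 p.L) :
    p.hamiltonianHier m (p.phiHier (m + 1) n) x
      = (p.energyHier (m + 1) n : ℂ) * p.phiHier (m + 1) n x := by
  have hwave := isWave_phiHier hħ hM hL hν (m + 1) n
  have hAAdag := (hwave.lower_hierPoly hħ hM hL hν).raise_hierPoly hħ hM hL hν
  have heps : (p.eps0 : ℂ) = ((1 / (2 * p.M) : ℝ) : ℂ) * (p.momentum : ℂ) ^ 2 := by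
    rw [← Complex.ofReal_pow, ← Complex.ofReal_mul, ← two_mul_M_mul_eps0 hM hL]
    congr 1
    field_simp
  rw [hamiltonianHier, hAAdag hx, hwave hx, energyHier_eq, energyHier_eq, Nat.zero_add, energy_eq,
    energy_eq, Complex.ofReal_mul, Complex.ofReal_mul, Complex.ofReal_sub, heps]
  ring

theorem isNormalizedEigenfunctionHier_phiHier (hħ : 0 < p.ħ) (hM : 0 < p.M) (hL : 0 < p.L)
    (hν : -1 < p.ν) (m n : ℕ) :
    p.IsNormalizedEigenfunctionHier m (p.energyHier (m + 1) n) (p.phiHier (m + 1) n) := by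
  have hwave := isWave_phiHier hħ hM hL hν (m + 1) n
  have hm : m < n + (m + 1) := by omega
  exact ⟨⟨hwave.memDomAdag hħ hM hL hν hm,
      (hwave.lower_hierPoly hħ hM hL hν).memDomA hħ hM hL hν hm⟩,
    isUnitVector_phiHier hħ hM hL hν (m + 1) n,
    fun x hx => hamiltonianHier_phiHier hħ hM hL hν m n hx⟩

theorem opB_phi (hħ : 0 < p.ħ) (hM : 0 < p.M) (hL : 0 < p.L) (hν : -1 < p.ν) (n m : ℕ) (x : ℝ) :
    p.opB m (p.phi (n + m + 1)) x
      = (p.momentum : ℂ) ^ (m + 1) * p.calM n m * p.phiHier (m + 1) n x := by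
  have hnorm : (p.normHier (m + 1) n : ℂ) ≠ 0 :=
    Complex.ofReal_ne_zero.2 (normHier_pos hħ hM hL hν (m + 1) n).ne'
  rw [calM_eq hν, ← Complex.ofReal_pow, ← Complex.ofReal_mul, ← normHier_eq hħ hM hL, phiHier,
    mul_div_cancel₀ _ hnorm, opB, add_assoc]

theorem opBdag_phiHier (hħ : 0 < p.ħ) (hM : 0 < p.M) (hL : 0 < p.L) (hν : -1 < p.ν) (n m : ℕ)
    (hx : x ∈ Ioo 0 p.L) :
    p.opBdag m (p.phiHier (m + 1) n) x
      = (p.momentum : ℂ) ^ (m + 1) * p.calM n m * p.phi (n + m + 1) x := by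
  have hm := Nat.le_add_left (m + 1) n
  have hsqrt : (p.gapProd (n + (m + 1)) (m + 1) : ℂ)
      = (√(p.gapProd (n + (m + 1)) (m + 1)) : ℝ) * (√(p.gapProd (n + (m + 1)) (m + 1)) : ℝ) := by
    rw [← Complex.ofReal_mul, Real.mul_self_sqrt (gapProd_pos hν hm).le]
  have hne := sqrt_gapProd_ne_zero hν hm
  rw [opBdag, (isWave_phiHier hħ hM hL hν (m + 1) n).ladderDag hħ hM hL hν hx, add_assoc,
    isWave_phi (n + (m + 1)) hx, calM_eq hν, hsqrt]
  field_simp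

end Hierarchy

end PoschlTeller

theorem proposition4_general (p : PoschlTeller) (hħ : 0 < p.ħ) (hM : 0 < p.M) (hL : 0 < p.L)
    (hν : -1 < p.ν) (n m : ℕ) :
    (∀ k ≤ m, ∀ x ∈ Ioo 0 p.L, p.phiHier k 0 x ≠ 0) ∧
    (∀ k ≤ m + 1, ∀ j : ℕ, ContDiffOn ℝ ∞ (p.phiHier k j) (Ioo 0 p.L)) ∧
    p.IsNormalizedEigenfunction (p.energy n) (p.phi n) ∧
    p.IsNormalizedEigenfunctionHier m (p.energyHier (m + 1) n) (p.phiHier (m + 1) n) ∧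
    p.MemDomBdag m (p.phiHier (m + 1) n) ∧
    (∀ x ∈ Ioo 0 p.L,
      p.opBdag m (p.phiHier (m + 1) n) x =
        ((2 : ℝ) ^ ((n : ℝ) + m + p.ν + 2) : ℝ) * ((p.ħ * Real.pi / p.L : ℝ) : ℂ) ^ (m + 1)
          * p.calT (n + m + 1) * ((p.L : ℂ) * p.calO (n + m + 1)) ^ (-(1 / 2) : ℂ)
          * (Real.exp (p.β * Real.pi / ((n : ℝ) + m + p.ν + 2) * (1 / 2 - x / p.L)) : ℝ)
          * p.calM n m
          * ((Real.sin (Real.pi * x / p.L) ^ ((n : ℝ) + m + p.ν + 2) : ℝ) : ℂ)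
          * jacobiP (n + m + 1) (p.aParam (n + m + 1)) (starRingEnd ℂ (p.aParam (n + m + 1)))
              (Complex.I * (Real.cot (Real.pi * x / p.L) : ℝ))) ∧
    p.MemDomB m (p.phi (n + m + 1)) ∧
    (∀ x ∈ Ioo 0 p.L,
      p.opB m (p.phi (n + m + 1)) x =
        ((Real.pi * p.ħ / p.L : ℝ) : ℂ) ^ (m + 1) * p.calM n m * p.phiHier (m + 1) n x) := by
  have hexpo : p.expo (n + m + 1) = n + m + p.ν + 2 := by
    rw [PoschlTeller.expo]
    push_cast
    ring
  refine ⟨fun k _ x hx => PoschlTeller.phiHier_zero_ne_zero hħ hM hL hν k hx,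
    fun k _ j => (PoschlTeller.isWave_phiHier hħ hM hL hν k j).contDiffOn,
    PoschlTeller.isNormalizedEigenfunction_phi hħ hM hL hν n,
    PoschlTeller.isNormalizedEigenfunctionHier_phiHier hħ hM hL hν m n,
    (PoschlTeller.isWave_phiHier hħ hM hL hν (m + 1) n).memDomLadderDag hħ hM hL hν
      (Nat.le_add_left _ _), fun x hx => ?_,
    PoschlTeller.memDomLadder_phi hħ hM hL hν (by omega), fun x _ => ?_⟩
  · rw [PoschlTeller.opBdag_phiHier hħ hM hL hν n m hx, PoschlTeller.phi_eq hL hν, hexpo,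
      PoschlTeller.momentum]
    ring
  · rw [PoschlTeller.opB_phi hħ hM hL hν, PoschlTeller.momentum, mul_comm p.ħ]

theorem proposition4 (p : PoschlTeller) (hħ : 0 < p.ħ) (hM : 0 < p.M) (hL : 0 < p.L)
    (hν : 0 ≤ p.ν) (hβ : 0 ≤ p.β) (n m : ℕ) :
    -- the ground states have no zeros and all functions involved are smooth on `(0, L)`
    (∀ k ≤ m, ∀ x ∈ Ioo 0 p.L, p.phiHier k 0 x ≠ 0) ∧
    (∀ k ≤ m + 1, ∀ j : ℕ, ContDiffOn ℝ ∞ (p.phiHier k j) (Ioo 0 p.L)) ∧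
    -- the functions acted upon are normalized eigenfunctions
    p.IsNormalizedEigenfunction (p.energy n) (p.phi n) ∧
    p.IsNormalizedEigenfunctionHier m (p.energyHier (m + 1) n) (p.phiHier (m + 1) n) ∧
    -- the action of `B_m†`
    p.MemDomBdag m (p.phiHier (m + 1) n) ∧
    (∀ x ∈ Ioo 0 p.L,
      p.opBdag m (p.phiHier (m + 1) n) x =
        ((2 : ℝ) ^ ((n : ℝ) + m + p.ν + 2) : ℝ) * ((p.ħ * Real.pi / p.L : ℝ) : ℂ) ^ (m + 1)
          * p.calT (n + m + 1) * ((p.L : ℂ) * p.calO (n + m + 1)) ^ (-(1 / 2) : ℂ)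
          * (Real.exp (p.β * Real.pi / ((n : ℝ) + m + p.ν + 2) * (1 / 2 - x / p.L)) : ℝ)
          * p.calM n m
          * ((Real.sin (Real.pi * x / p.L) ^ ((n : ℝ) + m + p.ν + 2) : ℝ) : ℂ)
          * jacobiP (n + m + 1) (p.aParam (n + m + 1)) (starRingEnd ℂ (p.aParam (n + m + 1)))
              (Complex.I * (Real.cot (Real.pi * x / p.L) : ℝ))) ∧
    -- the action of `B_m`
    p.MemDomB m (p.phi (n + m + 1)) ∧
    (∀ x ∈ Ioo 0 p.L,
      p.opB m (p.phi (n + m + 1)) x =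
        ((Real.pi * p.ħ / p.L : ℝ) : ℂ) ^ (m + 1) * p.calM n m * p.phiHier (m + 1) n x) :=
  proposition4_general p hħ hM hL (by linarith) n m
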